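/- Let $N$ be a closed connected smooth manifold (compact, Hausdorff, without boundary), $M=T^*N$ with projection $\pi\colon M\to N$ and its standard symplectic form $\omega_0=\sum_i dq_i\wedge dp_i$, and let $\Sigma\subset T^*N$ be compact. For $F\in C^\infty(M)$ let $X_F$ be defined by $\iota_{X_F}\omega_0=-dF$ and put $\{F,G\}=\omega_0(X_F,X_G)$. Let $\mathrm{Ham}(M)$ be the set of time-one maps $\varphi^1$ of the isotopies given by $\varphi^0=\mathrm{id}$, $\frac{d}{dt}\varphi^t=X_{H_t}\circ\varphi^t$, where $H_t$ is a smooth, one-periodic in time, compactly supported Hamiltonian. A set $X\subset M$ is displaceable from $Y\subset M$ if $\phi(X)\cap\overline{Y}=\emptyset$ for some $\phi\in\mathrm{Ham}(M)$, and non-displaceable from $Y$ otherwise; it is called displaceable if it is displaceable from itself. A partial symplectic quasi-state on $(M,\omega_0)$ is a functional $\zeta\colon C_c(M)\to\mathbb{R}$ on the compactly supported continuous functions such that: (1) there is a non-empty compact $K\subset M$ such that $\zeta(F)=a$ for all $a\in\mathbb{R}$ and all $F\in C_c(M)$ with $F|_K\equiv a$; (2) $\min_M(H_1-H_2)\le\zeta(H_1)-\zeta(H_2)\le\max_M(H_1-H_2)$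 for all $H_1,H_2\in C_c(M)$; (3) $\zeta(sH)=s\,\zeta(H)$ for all $H\in C_c(M)$ and $s>0$; (4) $\zeta(H\circ\phi)=\zeta(H)$ for all $H\in C_c(M)$ and $\phi\in\mathrm{Ham}(M)$; (5) $\zeta(H)=0$ for all $H\in C_c(M)$ whose support is displaceable; (6) $\zeta(H_1+H_2)\le\zeta(H_1)+\zeta(H_2)$ for all $H_1,H_2\in C_c^\infty(M)$ with $\{H_1,H_2\}=0$. A compact set $X\subset M$ is $\zeta$-superheavy if $\zeta(H)\le\sup_X H$ for all $H\in C_c(M)$. Let $H\colon T^*N\to\mathbb{R}$ be a smooth function satisfying condition $(\star)_\Sigma$: the sublevel set $H^{-1}((-\infty,c])$ is compact for every $c\in\mathbb{R}$, and for every $q\in N$ the restriction of $H$ to $T_q^*N\cap\Sigma$ is identically equal to $\min_{p\in T_q^*N}H(q,p)$. Put $m_H=\max_{q\in N}\min_{p\in T_q^*N}H(q,p)$. If there exists a partial symplectic quasi-state $\zeta$ on $(T^*N,\omega_0)$ such that $\Sigma$ is $\zeta$-superheavy, then the level set $H^{-1}(m_H)\subset T^*N$ is non-displaceable from itself and from $\Sigma$.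 -/

import Mathlib

open Set Function Manifold ContDiff
open scoped Bundle CompactlySupported

noncomputable section

namespace CotangentQS

/-- The model space `ℝⁿ` of an `n`-dimensional manifold. -/
abbrev Base (n : ℕ) : Type := EuclideanSpace ℝ (Fin n)

/-- The dual space `(ℝⁿ)*`. -/
abbrev Dual (n : ℕ) : Type := Base n →L[ℝ] ℝ

variable {n : ℕ} {N : Type*} [TopologicalSpace N] [ChartedSpace (Base n) N]
  [IsManifold (𝓡 n) ∞ N]

variable (n N) in
/-- The cotangent bundle `T*N`: its points are pairs `⟨q, p⟩` with `q : N` and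
`p : TangentSpace (𝓡 n) q →L[ℝ] ℝ`. Mathlib's bundle of continuous linear maps provides the
topology and the charts: the preferred chart at a point over `q₀` is the canonical chart
`(q¹, …, qⁿ, p₁, …, pₙ)` induced by the preferred chart of `N` at `q₀`. -/
abbrev Cotangent : Type _ :=
  Bundle.TotalSpace (Dual n) (fun q : N => TangentSpace (𝓡 n) q →L[ℝ] Bundle.Trivial N ℝ q)

variable (n) in
/-- The model with corners of the `2n`-dimensional manifold `T*N`. -/
abbrev cotangentModel : ModelWithCorners ℝ (Base n × Dual n) (ModelProd (Base n) (Dual n)) :=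
  (𝓡 n).prod 𝓘(ℝ, Dual n)

/-- The tangent space of `T*N` at `x`. By Mathlib's convention it is the model space
`ℝⁿ × (ℝⁿ)*`, through the preferred chart at `x`; a tangent vector is thus the pair `(δq, δp)` of
its components in canonical coordinates. -/
abbrev Tangent (x : Cotangent n N) : Type := TangentSpace (cotangentModel n) x

/-- The standard symplectic form `ω₀ = ∑ dqⁱ ∧ dpᵢ = -d(∑ pᵢ dqⁱ)`, in the canonical coordinates
around `x`: `ω₀ (δq, δp) (δq', δp') = δp' δq - δp δq'`. -/
def omega (x : Cotangent n N) (v w : Tangent x) : ℝ :=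
  let v' : Base n × Dual n := v
  let w' : Base n × Dual n := w
  w'.2 v'.1 - v'.2 w'.1

/-- The coordinate vector field `∂/∂qⁱ` of the canonical chart around `x`, at `x`. -/
def partialQ (x : Cotangent n N) (i : Fin n) : Tangent x :=
  ((EuclideanSpace.single i (1 : ℝ), 0) : Base n × Dual n)

/-- The coordinate vector field `∂/∂pᵢ` of the canonical chart around `x`, at `x`. -/
def partialP (x : Cotangent n N) (i : Fin n) : Tangent x :=
  ((0, EuclideanSpace.proj i) : Base n × Dual n)

/-- The differential of a function on `T*N` at `x`. -/
def differential (F : Cotangent n N → ℝ) (x : Cotangent n N) (v : Tangent x) : ℝ :=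
  mfderiv (cotangentModel n) 𝓘(ℝ, ℝ) F x v

/-- The Hamiltonian vector field `X_F = ∑ᵢ (∂F/∂qⁱ) ∂/∂pᵢ - (∂F/∂pᵢ) ∂/∂qⁱ`. -/
def hamVF (F : Cotangent n N → ℝ) (x : Cotangent n N) : Tangent x :=
  ∑ i : Fin n, (differential F x (partialQ x i) • partialP x i
    - differential F x (partialP x i) • partialQ x i)

theorem tangent_eq_sum (x : Cotangent n N) (w : Base n × Dual n) :
    (w : Tangent x) = ∑ i : Fin n, (w.1 i • partialQ x i
      + w.2 (EuclideanSpace.single i (1 : ℝ)) • partialP x i) := by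
  change w = ∑ i : Fin n, (w.1 i • ((EuclideanSpace.single i (1 : ℝ), 0) : Base n × Dual n)
    + w.2 (EuclideanSpace.single i (1 : ℝ)) • ((0, EuclideanSpace.proj i) : Base n × Dual n))
  have h1 : ∀ a : Base n, a = ∑ i : Fin n, a i • EuclideanSpace.single i (1 : ℝ) := by
    intro a
    ext j
    simp [Pi.single_apply]
  refine Prod.ext ?_ ?_
  · simpa [Prod.fst_sum] using h1 w.1
  · refine ContinuousLinearMap.ext fun a => ?_
    conv_lhs => rw [h1 a]
    simp [Prod.snd_sum, mul_comm]

/-- `X_F` is the vector field determined by `ι_{X_F} ω₀ = -dF`. -/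
theorem eq_hamVF_iff (F : Cotangent n N → ℝ) (x : Cotangent n N) (v : Tangent x) :
    v = hamVF F x ↔ ∀ w : Tangent x, omega x v w = -differential F x w := by
  obtain ⟨D, hD⟩ : ∃ D : (Base n × Dual n) →ₗ[ℝ] ℝ, ∀ w, differential F x w = D w :=
    ⟨(mfderiv (cotangentModel n) 𝓘(ℝ, ℝ) F x).toLinearMap, fun _ => rfl⟩
  have hsum : hamVF F x = ∑ i : Fin n,
      (D (EuclideanSpace.single i (1 : ℝ), 0) • ((0, EuclideanSpace.proj i) : Base n × Dual n)
      - D (0, EuclideanSpace.proj i)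
        • ((EuclideanSpace.single i (1 : ℝ), 0) : Base n × Dual n)) := by
    unfold hamVF
    simp only [hD]
    rfl
  have key : ∀ w : Tangent x, omega x (hamVF F x) w = -differential F x w := by
    intro w
    rw [hD]
    have hw : D w = ∑ i : Fin n, ((w : Base n × Dual n).1 i * D (EuclideanSpace.single i (1 : ℝ), 0)
        + (w : Base n × Dual n).2 (EuclideanSpace.single i (1 : ℝ))
          * D (0, EuclideanSpace.proj i)) := by
      have := congrArg D (tangent_eq_sum x w)
      rw [this]
      erw [map_sum]
      refine Finset.sum_congr rfl fun i _ => ?_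
      erw [map_add, map_smul, map_smul]
      rfl
    rw [hw, hsum]
    simp only [omega, Prod.fst_sum, Prod.snd_sum, Prod.fst_sub, Prod.snd_sub, Prod.smul_fst,
      Prod.smul_snd, smul_zero, sub_zero, zero_sub, map_sum, map_neg, map_smul,
      sum_apply, smul_apply, smul_eq_mul,
      PiLp.proj_apply, Finset.sum_add_distrib, Finset.sum_neg_distrib]
    rw [neg_add]
    rw [sub_eq_add_neg, add_comm]
    congr 2 <;> exact Finset.sum_congr rfl fun i _ => mul_comm _ _
  refine ⟨fun h => h ▸ key, fun h => ?_⟩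
  have h2 : ∀ w : Base n × Dual n,
      w.2 (v : Base n × Dual n).1 - (v : Base n × Dual n).2 w.1
        = w.2 (hamVF F x : Base n × Dual n).1 - (hamVF F x : Base n × Dual n).2 w.1 :=
    fun w => (h w).trans (key w).symm
  refine Prod.ext ?_ ?_
  · ext i
    simpa using h2 (0, EuclideanSpace.proj i)
  · refine ContinuousLinearMap.ext fun a => ?_
    simpa using h2 (a, 0)

/-- The Poisson bracket `{F, G} = ω₀(X_F, X_G)`. -/
def poisson (F G : Cotangent n N → ℝ) (x : Cotangent n N) : ℝ :=
  omega x (hamVF F x) (hamVF G x)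

/-- Smooth functions on `T*N`. -/
def IsSmooth (F : Cotangent n N → ℝ) : Prop :=
  ContMDiff (cotangentModel n) 𝓘(ℝ, ℝ) ∞ F

/-- Compactly supported time-dependent Hamiltonians: smooth, one-periodic in time, and supported
in one compact set for all times. -/
structure IsCompactHamiltonian (H : ℝ → Cotangent n N → ℝ) : Prop where
  smooth : ContMDiff (𝓘(ℝ, ℝ).prod (cotangentModel n)) 𝓘(ℝ, ℝ) ∞
    (fun z : ℝ × Cotangent n N => H z.1 z.2)
  periodic : ∀ t x, H (t + 1) x = H t x
  compactSupport : ∃ K : Set (Cotangent n N), IsCompact K ∧ ∀ t, ∀ x ∉ K, H t x = 0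

/-- `φ` is the Hamiltonian isotopy of `H`: `φ⁰ = id` and `d/dt φᵗ = X_{H_t} ∘ φᵗ`. Uniqueness of
solutions, and smoothness of `φ` beyond the continuity recorded here, are automatic for compactly
supported `H`. -/
structure IsHamiltonianIsotopy (H : ℝ → Cotangent n N → ℝ)
    (φ : ℝ → Cotangent n N → Cotangent n N) : Prop where
  continuous : Continuous (fun z : ℝ × Cotangent n N => φ z.1 z.2)
  zero : ∀ x, φ 0 x = x
  deriv : ∀ t x, HasMFDerivAt 𝓘(ℝ, ℝ) (cotangentModel n) (fun s => φ s x) t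
    ((1 : ℝ →L[ℝ] ℝ).smulRight (hamVF (H t) (φ t x)))

variable (n N) in
/-- `Ham(T*N)`: the time-one maps of the compactly supported Hamiltonians. -/
def Ham : Set (Cotangent n N → Cotangent n N) :=
  {ψ | ∃ H φ, IsCompactHamiltonian H ∧ IsHamiltonianIsotopy H φ ∧ ψ = φ 1}

/-- `X` is displaceable from `Y`: some `ψ ∈ Ham(T*N)` has `ψ(X) ∩ closure Y = ∅`. -/
def Displaceable (X Y : Set (Cotangent n N)) : Prop :=
  ∃ ψ ∈ Ham n N, ψ '' X ∩ closure Y = ∅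

variable (n N) in
/-- Partial symplectic quasi-states on `(T*N, ω₀)`. -/
structure PartialSymplecticQuasiState where
  /-- The functional `ζ : C_c(T*N) → ℝ`. -/
  toFun : C_c(Cotangent n N, ℝ) → ℝ
  normalization : ∃ K : Set (Cotangent n N), K.Nonempty ∧ IsCompact K ∧
    ∀ (a : ℝ) (F : C_c(Cotangent n N, ℝ)), (∀ x ∈ K, F x = a) → toFun F = a
  stability : ∀ H₁ H₂ : C_c(Cotangent n N, ℝ),
    (⨅ x, (H₁ x - H₂ x)) ≤ toFun H₁ - toFun H₂ ∧ toFun H₁ - toFun H₂ ≤ ⨆ x, (H₁ x - H₂ x)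
  semiHomogeneity : ∀ (s : ℝ) (H : C_c(Cotangent n N, ℝ)), 0 < s → toFun (s • H) = s * toFun H
  /-- `ζ(H ∘ ψ) = ζ(H)`, the composite being written as an element `H'` of `C_c(T*N)`. -/
  hamInvariance : ∀ ψ ∈ Ham n N, ∀ H H' : C_c(Cotangent n N, ℝ),
    (∀ x, H' x = H (ψ x)) → toFun H' = toFun H
  vanishing : ∀ H : C_c(Cotangent n N, ℝ),
    Displaceable (tsupport H) (tsupport H) → toFun H = 0
  quasiSubadditivity : ∀ H₁ H₂ : C_c(Cotangent n N, ℝ), IsSmooth (n := n) (N := N) H₁ →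
    IsSmooth (n := n) (N := N) H₂ → (∀ x, poisson (n := n) (N := N) H₁ H₂ x = 0) →
    toFun (H₁ + H₂) ≤ toFun H₁ + toFun H₂

/-- `X` is `ζ`-superheavy: `X` is compact and `ζ(H) ≤ sup_X H` for all `H ∈ C_c(T*N)`. The
supremum is taken in the extended reals. -/
def IsSuperheavy (ζ : PartialSymplecticQuasiState n N) (X : Set (Cotangent n N)) : Prop :=
  IsCompact X ∧ ∀ H : C_c(Cotangent n N, ℝ), (ζ.toFun H : EReal) ≤ ⨆ x ∈ X, (H x : EReal)

/-- The fibrewise minimum `min_{p ∈ T_q^*N} H(q, p)`. -/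
def fiberMin (H : Cotangent n N → ℝ) (q : N) : ℝ :=
  ⨅ p : TangentSpace (𝓡 n) q →L[ℝ] Bundle.Trivial N ℝ q, H ⟨q, p⟩

/-- Condition `(⋆)_Σ` on a function `H` on `T*N` : its sublevel sets are compact, and on each
`T_q^*N ∩ Σ` it is identically equal to `min_{p ∈ T_q^*N} H(q, p)`. -/
structure StarCondition (S : Set (Cotangent n N)) (H : Cotangent n N → ℝ) : Prop where
  isCompact_sublevel : ∀ c : ℝ, IsCompact (H ⁻¹' Iic c)
  eq_fiberMin : ∀ x ∈ S, H x = fiberMin H x.proj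

/-- `m_H = max_{q ∈ N} min_{p ∈ T_q^*N} H(q, p)`. -/
def maxMin (H : Cotangent n N → ℝ) : ℝ := ⨆ q : N, fiberMin H q

end CotangentQS

end

/-! Write m for `maxMin H`. For c < m some cotangent fibre has minimum of H above c, so the compact
sublevel set A = {H ≤ c} projects to a proper compact subset of N. Choose a smooth f on N whose
critical points all avoid that projection. The Hamiltonian flow of C·f∘π translates fibres by
multiples of C·df; momenta over A are bounded and df has no zero there, so for large C the time-one
map moves A off itself. Cutting the Hamiltonian off far out makes it compactly supported
(`displaceable_sublevel`).

Now split a cutoff of H as a(H) + b(H), with a supported below m, b concentrated near m, and a + b =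
1 on (-∞, m]. These functions Poisson commute. Vanishing gives ζ(a(H)) = 0. Condition (⋆) puts Σ
inside {H ≤ m}, so superheaviness gives ζ(-(a+b)(H)) ≤ -1. Two uses of quasi-subadditivity yield
ζ(b(H)) ≥ 1: functions supported arbitrarily near the level m can have positive ζ
(`exists_pos_of_isSuperheavy`).

If the level were displaceable from itself, so would be a neighbourhood, contradicting vanishing. If
some ψ moved it off Σ, a bump function equal to 1 on the image of a neighbourhood and 0 on Σ would,
pulled back by ψ, dominate b(H) while having ζ ≤ 0.

The function f comes from differential topology: a generic combination of cut-off coordinates has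
finitely many critical points (`exists_contMDiff_finite_critical`), and connectedness allows these
to be pushed into any non-empty open set (`exists_contMDiff_critical_subset`). -/

open scoped Topology

noncomputable section

/-! ### Global continuous flows of compactly supported vector fields. -/

section Flow

variable {E : Type*} [NormedAddCommGroup E] [NormedSpace ℝ E] [CompleteSpace E]
  {H : Type*} [TopologicalSpace H] {I : ModelWithCorners ℝ E H}
  {M : Type*} [TopologicalSpace M] [ChartedSpace H M] [IsManifold I 1 M]
  [BoundarylessManifold I M] {v : (x : M) → TangentSpace I x}

/-- A `C¹` vector field has a continuous local flow around every point. -/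
theorem exists_continuousOn_localFlow {x₀ : M}
    (hv : ContMDiffAt I I.tangent 1 (fun x ↦ (⟨x, v x⟩ : TangentBundle I M)) x₀) :
    ∃ U ∈ 𝓝 x₀, ∃ ε > (0 : ℝ), ∃ α : M × ℝ → M,
      (∀ x ∈ U, α (x, 0) = x ∧ IsMIntegralCurveOn (fun t => α (x, t)) v (Ioo (-ε) ε)) ∧
      ContinuousOn α (U ×ˢ Ioo (-ε) ε) := by
  have hx : I.IsInteriorPoint x₀ := BoundarylessManifold.isInteriorPoint
  rw [contMDiffAt_iff] at hv
  obtain ⟨_, hv⟩ := hv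
  obtain ⟨ε, hε, a, r, _, _, hr, hpl⟩ := IsPicardLindelof.of_contDiffAt_one
    (hv.contDiffAt (range_mem_nhds_isInteriorPoint hx)).snd
  obtain ⟨β, hβ, hβc⟩ :=
    (hpl 0).exists_forall_mem_closedBall_eq_hasDerivWithinAt_continuousOn
  simp only [zero_sub, zero_add] at hβ hβc
  set z₀ := extChartAt I x₀ x₀ with hz₀
  have hr' : (0 : ℝ) < r := hr
  have hnb : Metric.closedBall z₀ r ×ˢ Icc (-ε) ε ∈ 𝓝 (z₀, (0 : ℝ)) :=
    prod_mem_nhds (Metric.closedBall_mem_nhds _ hr') (Icc_mem_nhds (by linarith) hε)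
  have hβat : ContinuousAt β (z₀, 0) := hβc.continuousAt hnb
  have hβ0 : β (z₀, 0) = z₀ := (hβ z₀ (Metric.mem_closedBall_self hr'.le)).1
  have hpre : β ⁻¹' interior (extChartAt I x₀).target ∈ 𝓝 (z₀, (0 : ℝ)) := by
    apply hβat
    rw [hβ0]
    exact isOpen_interior.mem_nhds ((I.isInteriorPoint_iff).mp hx)
  -- Shrink the initial ball and the time interval so that the chart solutions stay inside the chart
  -- target and can be pulled back to `M`.
  obtain ⟨A, hA, B, hB, hAB⟩ := mem_nhds_prod_iff.mp (Filter.inter_mem hnb hpre)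
  obtain ⟨δ, hδ, hδB⟩ := Metric.mem_nhds_iff.mp hB
  have hδB' : ∀ t ∈ Ioo (-δ) δ, t ∈ B := by
    intro t ht
    apply hδB
    rw [Real.ball_eq_Ioo]
    simpa using ht
  have hz₀A : z₀ ∈ A := mem_of_mem_nhds hA
  have h0B : (0 : ℝ) ∈ B := mem_of_mem_nhds hB
  have hAr : A ⊆ Metric.closedBall z₀ r := fun z hz => (hAB (mk_mem_prod hz h0B)).1.1
  have hBε : Ioo (-δ) δ ⊆ Icc (-ε) ε := fun t ht =>
    (hAB (mk_mem_prod hz₀A (hδB' t ht))).1.2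
  have hopen : ∀ t ∈ Ioo (-δ) δ, Icc (-ε) ε ∈ 𝓝 t := fun t ht =>
    Filter.mem_of_superset (isOpen_Ioo.mem_nhds ht) hBε
  refine ⟨(extChartAt I x₀).source ∩ extChartAt I x₀ ⁻¹' A,
    Filter.inter_mem (extChartAt_source_mem_nhds x₀)
      ((continuousAt_extChartAt x₀).preimage_mem_nhds hA), δ, hδ,
    fun p => (extChartAt I x₀).symm (β (extChartAt I x₀ p.1, p.2)), ?_, ?_⟩
  · rintro x ⟨hxs, hxA⟩
    have hxA' : extChartAt I x₀ x ∈ A := hxA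
    refine ⟨?_, ?_⟩
    · simp only [(hβ _ (hAr hxA')).1, PartialEquiv.left_inv _ hxs]
    intro t ht
    set f : ℝ → E := fun t => β (extChartAt I x₀ x, t) with hf
    set xₜ : M := (extChartAt I x₀).symm (f t) with hxₜ
    have hd := ((hβ _ (hAr hxA')).2 t (hBε ht)).hasDerivAt (hopen t ht)
    have h : HasDerivAt f (fderivWithin ℝ (extChartAt I x₀ ∘ (extChartAt I xₜ).symm)
      (range I) (extChartAt I xₜ xₜ) (v xₜ)) t := hd
    -- The chart solution moves with `v xₜ` read in the chart at `x₀`. The opposite coordinate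
    -- change, `hcc` below, cancels this and returns `v xₜ`.
    rw [← tangentCoordChange_def] at h
    have hf3 : f t ∈ interior (extChartAt I x₀).target :=
      (hAB (mk_mem_prod hxA' (hδB' t ht))).2
    have hf3' := mem_of_mem_of_subset hf3 interior_subset
    have hft1 := mem_preimage.mp <|
      mem_of_mem_of_subset hf3' (extChartAt I x₀).target_subset_preimage_source
    have hft2 := mem_extChartAt_source (I := I) xₜ
    apply HasMFDerivAt.hasMFDerivWithinAt
    suffices hd' : HasDerivAt ((extChartAt I xₜ ∘ (extChartAt I x₀).symm) ∘ f) (v xₜ : E) t from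
      ⟨(continuousAt_extChartAt_symm'' hf3').comp h.continuousAt,
        hd'.hasFDerivAt.hasFDerivWithinAt⟩
    have hcc : HasFDerivAt (extChartAt I xₜ ∘ (extChartAt I x₀).symm)
        (tangentCoordChange I x₀ xₜ xₜ) (f t) := by
      apply HasFDerivWithinAt.hasFDerivAt (s := range I) _ <|
        mem_nhds_iff.mpr ⟨interior (extChartAt I x₀).target,
          subset_trans interior_subset (extChartAt_target_subset_range ..),
          isOpen_interior, hf3⟩
      rw [← (extChartAt I x₀).right_inv hf3']
      exact hasFDerivWithinAt_tangentCoordChange ⟨hft1, hft2⟩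
    exact (hcc.comp_hasDerivAt t h).congr_deriv
      ((tangentCoordChange_comp ⟨⟨hft2, hft1⟩, hft2⟩).trans (tangentCoordChange_self hft2))
  · rintro ⟨x, t⟩ ⟨⟨hxs, hxA⟩, ht⟩
    have hxA' : extChartAt I x₀ x ∈ A := hxA
    have hf3 : β (extChartAt I x₀ x, t) ∈ interior (extChartAt I x₀).target :=
      (hAB (mk_mem_prod hxA' (hδB' t ht))).2
    have h1 : ContinuousWithinAt (fun p : M × ℝ => (extChartAt I x₀ p.1, p.2))
        (((extChartAt I x₀).source ∩ extChartAt I x₀ ⁻¹' A) ×ˢ Ioo (-δ) δ) (x, t) := by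
      apply ContinuousAt.continuousWithinAt
      have h2 : ContinuousAt (extChartAt I x₀) x := continuousAt_extChartAt' hxs
      exact ContinuousAt.prodMk (ContinuousAt.comp (f := Prod.fst) h2 continuousAt_fst)
        continuousAt_snd
    have h3 : ContinuousWithinAt (β ∘ (fun p : M × ℝ => (extChartAt I x₀ p.1, p.2)))
        (((extChartAt I x₀).source ∩ extChartAt I x₀ ⁻¹' A) ×ˢ Ioo (-δ) δ) (x, t) := by
      refine ContinuousWithinAt.comp (hβc _ ⟨hAr hxA', hBε ht⟩) h1 ?_
      rintro ⟨y, s⟩ ⟨⟨-, hyA⟩, hs⟩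
      exact ⟨hAr hyA, hBε hs⟩
    exact ContinuousAt.comp_continuousWithinAt (g := (extChartAt I x₀).symm)
      (continuousAt_extChartAt_symm'' (interior_subset hf3)) h3

variable [T2Space M]

/-- A compactly supported `C¹` vector field has a globally defined, jointly continuous flow. -/
theorem exists_continuous_flow_of_compact_support
    (hv : ContMDiff I I.tangent 1 (fun x ↦ (⟨x, v x⟩ : TangentBundle I M)))
    {K : Set M} (hK : IsCompact K) (hvK : ∀ x ∉ K, v x = 0) :
    ∃ φ : ℝ → M → M, Continuous (fun z : ℝ × M => φ z.1 z.2) ∧ (∀ x, φ 0 x = x) ∧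
      ∀ x, IsMIntegralCurve (fun t => φ t x) v := by
  -- Compactness of `K` makes the existence time uniform; off `K` constant curves exist for all
  -- time. A uniform existence time gives global curves.
  obtain ⟨ε, hε, hγ⟩ : ∃ ε > (0 : ℝ), ∀ x ∈ K, ∃ γ : ℝ → M, γ 0 = x ∧
      IsMIntegralCurveOn γ v (Ioo (-ε) ε) := by
    refine hK.induction_on (p := fun s => ∃ ε > (0 : ℝ), ∀ x ∈ s, ∃ γ : ℝ → M, γ 0 = x ∧
      IsMIntegralCurveOn γ v (Ioo (-ε) ε)) ⟨1, one_pos, by simp⟩ ?_ ?_ ?_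
    · rintro s t hst ⟨ε, hε, h⟩
      exact ⟨ε, hε, fun x hx => h x (hst hx)⟩
    · rintro s t ⟨ε, hε, h⟩ ⟨ε', hε', h'⟩
      refine ⟨min ε ε', lt_min hε hε', ?_⟩
      rintro x (hx | hx)
      · obtain ⟨γ, h0, hγ⟩ := h x hx
        exact ⟨γ, h0, hγ.mono (Ioo_subset_Ioo (neg_le_neg (min_le_left _ _)) (min_le_left _ _))⟩
      · obtain ⟨γ, h0, hγ⟩ := h' x hx
        exact ⟨γ, h0, hγ.mono (Ioo_subset_Ioo (neg_le_neg (min_le_right _ _)) (min_le_right _ _))⟩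
    · intro x _
      obtain ⟨U, hU, ε, hε, α, hα, -⟩ := exists_continuousOn_localFlow (hv x)
      exact ⟨U, mem_nhdsWithin_of_mem_nhds hU, ε, hε,
        fun y hy => ⟨fun t => α (y, t), (hα y hy).1, (hα y hy).2⟩⟩
  have hcurve : ∀ x : M, ∃ γ : ℝ → M, γ 0 = x ∧ IsMIntegralCurve γ v := by
    refine exists_isMIntegralCurve_of_isMIntegralCurveOn hv hε fun x => ?_
    by_cases hx : x ∈ K
    · exact hγ x hx
    · exact ⟨fun _ => x, rfl, (isMIntegralCurve_const (hvK x hx)).isMIntegralCurveOn _⟩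
  choose ψ hψ0 hψ using hcurve
  set Φ : ℝ × M → M := fun z => ψ z.2 z.1 with hΦ
  have hadd : ∀ s t x, ψ x (s + t) = ψ (ψ x t) s := by
    intro s t x
    have := isMIntegralCurve_Ioo_eq_of_contMDiff_boundaryless (t₀ := 0) hv
      ((hψ x).comp_add t) (hψ (ψ x t)) (by simp [hψ0])
    exact congrFun this s
  have hconst : ∀ x ∉ K, ∀ t, ψ x t = x := by
    intro x hx t
    have := isMIntegralCurve_Ioo_eq_of_contMDiff_boundaryless (t₀ := 0) hv
      (hψ x) (isMIntegralCurve_const (hvK x hx)) (by simp [hψ0])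
    exact congrFun this t
  obtain ⟨δ, hδ, hcont⟩ : ∃ δ > (0 : ℝ), ∀ x ∈ K, ∀ t ∈ Ioo (-δ) δ, ContinuousAt Φ (t, x) := by
    refine hK.induction_on (p := fun s => ∃ δ > (0 : ℝ), ∀ x ∈ s, ∀ t ∈ Ioo (-δ) δ,
      ContinuousAt Φ (t, x)) ⟨1, one_pos, by simp⟩ ?_ ?_ ?_
    · rintro s t hst ⟨ε, hε, h⟩
      exact ⟨ε, hε, fun x hx => h x (hst hx)⟩
    · rintro s t ⟨ε, hε, h⟩ ⟨ε', hε', h'⟩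
      refine ⟨min ε ε', lt_min hε hε', ?_⟩
      rintro x (hx | hx) t ht
      · exact h x hx t (Ioo_subset_Ioo (neg_le_neg (min_le_left _ _)) (min_le_left _ _) ht)
      · exact h' x hx t (Ioo_subset_Ioo (neg_le_neg (min_le_right _ _)) (min_le_right _ _) ht)
    · intro x _
      obtain ⟨U, hU, ε, hε, α, hα, hαc⟩ := exists_continuousOn_localFlow (hv x)
      refine ⟨interior U, mem_nhdsWithin_of_mem_nhds (interior_mem_nhds.mpr hU), ε, hε,
        fun y hy t ht => ?_⟩
      have hn : Ioo (-ε) ε ×ˢ interior U ∈ 𝓝 (t, y) :=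
        prod_mem_nhds (isOpen_Ioo.mem_nhds ht) (isOpen_interior.mem_nhds hy)
      have hc : ContinuousAt (fun z : ℝ × M => α (z.2, z.1)) (t, y) := by
        refine ContinuousAt.comp (f := Prod.swap) (g := α) (hαc.continuousAt ?_)
          continuous_swap.continuousAt
        exact prod_mem_nhds (mem_interior_iff_mem_nhds.mp hy) (isOpen_Ioo.mem_nhds ht)
      refine hc.congr ?_
      filter_upwards [hn] with z hz
      have hz2 := interior_subset hz.2
      exact isMIntegralCurveOn_Ioo_eqOn_of_contMDiff_boundaryless (t₀ := 0)
        ⟨by linarith, hε⟩ hv (hα z.2 hz2).2 ((hψ z.2).isMIntegralCurveOn _)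
        (by rw [(hα z.2 hz2).1, hψ0]) hz.1
  have hcont' : ∀ x, ∀ t ∈ Ioo (-δ) δ, ContinuousAt Φ (t, x) := by
    intro x t ht
    by_cases hx : x ∈ K
    · exact hcont x hx t ht
    · refine ContinuousAt.congr (f := Prod.snd) continuousAt_snd ?_
      have : univ ×ˢ Kᶜ ∈ 𝓝 (t, x) :=
        prod_mem_nhds Filter.univ_mem (hK.isClosed.isOpen_compl.mem_nhds hx)
      filter_upwards [this] with z hz
      exact (hconst z.2 hz.2 z.1).symm
  -- Continuity is known only for short times. Factoring the time-t flow into the times t(k+1)/(k+2)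
  -- and t/(k+2) enlarges the range by δ at each induction step.
  have hall : ∀ k : ℕ, ∀ x, ∀ t ∈ Ioo (-((k + 1) * δ)) ((k + 1) * δ), ContinuousAt Φ (t, x) := by
    intro k
    induction k with
    | zero => simpa using hcont'
    | succ k ih =>
      intro x t ht
      have hk : (0 : ℝ) < k + 2 := by positivity
      push_cast at ht
      have h1 : t * ((k + 1) / (k + 2)) ∈ Ioo (-((k + 1) * δ)) ((k + 1) * δ) := by
        have hk1 : (0 : ℝ) < (k + 1) / (k + 2) := by positivity
        have e : (k + 1) * δ = ((k + 1 + 1) * δ) * ((k + 1) / (k + 2)) := by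
          field_simp; ring
        rw [e, ← neg_mul]
        exact ⟨mul_lt_mul_of_pos_right ht.1 hk1, mul_lt_mul_of_pos_right ht.2 hk1⟩
      have h2 : t * (1 / (k + 2)) ∈ Ioo (-δ) δ := by
        have hk1 : (0 : ℝ) < 1 / (k + 2) := by positivity
        have e : δ = ((k + 1 + 1) * δ) * (1 / (k + 2)) := by
          field_simp; ring
        rw [e, ← neg_mul]
        exact ⟨mul_lt_mul_of_pos_right ht.1 hk1, mul_lt_mul_of_pos_right ht.2 hk1⟩
      have e : Φ = fun z : ℝ × M => Φ (z.1 * (1 / (k + 2)), Φ (z.1 * ((k + 1) / (k + 2)), z.2)) := by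
        funext z
        simp only [hΦ]
        rw [← hadd]
        congr 1
        field_simp; ring
      rw [e]
      have h3 : ContinuousAt (fun z : ℝ × M => Φ (z.1 * ((k + 1) / (k + 2)), z.2)) (t, x) :=
        ContinuousAt.comp (g := Φ) (f := fun z : ℝ × M => (z.1 * ((k + 1) / (k + 2)), z.2))
          (ih x _ h1) (by fun_prop)
      exact ContinuousAt.comp (g := Φ) (hcont' _ _ h2)
        (ContinuousAt.prodMk (by fun_prop) h3)
  refine ⟨fun t x => ψ x t, ?_, hψ0, hψ⟩
  refine continuous_iff_continuousAt.mpr fun ⟨t, x⟩ => ?_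
  obtain ⟨k, hk⟩ := exists_nat_gt (|t| / δ)
  refine hall k x t ?_
  rw [mem_Ioo, ← abs_lt]
  rw [div_lt_iff₀ hδ] at hk
  nlinarith

end Flow

namespace CotangentQS

/-! ### Linear symplectic algebra and cotangent lifts. -/

section Linear

variable {n : ℕ}

/-- The standard symplectic form on `ℝⁿ × (ℝⁿ)*`. -/
def stdOmega (v w : Base n × Dual n) : ℝ := w.2 v.1 - v.2 w.1

set_option synthInstance.maxHeartbeats 400000 in
/-- The linear isomorphism `α ↦ v` determined by `ω₀(v, ·) = -α`. -/
def omegaSharp : ((Base n × Dual n) →L[ℝ] ℝ) →L[ℝ] Base n × Dual n :=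
  ∑ i : Fin n,
    ((ContinuousLinearMap.apply ℝ ℝ ((EuclideanSpace.single i (1 : ℝ), 0) : Base n × Dual n)).smulRight
        ((0, EuclideanSpace.proj i) : Base n × Dual n)
      - (ContinuousLinearMap.apply ℝ ℝ ((0, EuclideanSpace.proj i) : Base n × Dual n)).smulRight
        ((EuclideanSpace.single i (1 : ℝ), 0) : Base n × Dual n))

set_option synthInstance.maxHeartbeats 400000 in
theorem omegaSharp_apply (D : (Base n × Dual n) →L[ℝ] ℝ) : omegaSharp D = ∑ i : Fin n,
    (D (EuclideanSpace.single i (1 : ℝ), 0) • ((0, EuclideanSpace.proj i) : Base n × Dual n)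
      - D (0, EuclideanSpace.proj i)
        • ((EuclideanSpace.single i (1 : ℝ), 0) : Base n × Dual n)) := by
  rw [omegaSharp, sum_apply]
  exact Finset.sum_congr rfl fun i _ => rfl

/-- Nondegeneracy: coordinate covectors detect the base component, and base vectors detect the fibre
component. -/
theorem stdOmega_left_ext {v v' : Base n × Dual n} (h : ∀ w, stdOmega v w = stdOmega v' w) :
    v = v' := by
  refine Prod.ext ?_ ?_
  · ext i
    simpa [stdOmega] using h (0, EuclideanSpace.proj i)
  · refine ContinuousLinearMap.ext fun a => ?_
    simpa [stdOmega] using h (a, 0)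

theorem stdOmega_omegaSharp (D : (Base n × Dual n) →L[ℝ] ℝ) (w : Base n × Dual n) :
    stdOmega (omegaSharp D) w = -D w := by
  have hw : D w = ∑ i : Fin n, (w.1 i * D (EuclideanSpace.single i (1 : ℝ), 0)
      + w.2 (EuclideanSpace.single i (1 : ℝ)) * D (0, EuclideanSpace.proj i)) := by
    have h1 : ∀ a : Base n, a = ∑ i : Fin n, a i • EuclideanSpace.single i (1 : ℝ) := by
      intro a
      ext j
      simp [Pi.single_apply]
    have h : w = ∑ i : Fin n, (w.1 i • ((EuclideanSpace.single i (1 : ℝ), 0) : Base n × Dual n)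
        + w.2 (EuclideanSpace.single i (1 : ℝ)) •
          ((0, EuclideanSpace.proj i) : Base n × Dual n)) := by
      refine Prod.ext ?_ ?_
      · simpa [Prod.fst_sum] using h1 w.1
      · refine ContinuousLinearMap.ext fun a => ?_
        conv_lhs => rw [h1 a]
        simp [Prod.snd_sum, mul_comm]
    conv_lhs => rw [h]
    simp only [map_sum, map_add, map_smul, smul_eq_mul]
  rw [hw]
  simp only [stdOmega, omegaSharp_apply, Prod.fst_sum, Prod.snd_sum, Prod.fst_sub, Prod.snd_sub, Prod.smul_fst,
    Prod.smul_snd, smul_zero, sub_zero, zero_sub, map_sum, map_neg, map_smul,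
    sum_apply, smul_apply, smul_eq_mul,
    PiLp.proj_apply, Finset.sum_add_distrib, Finset.sum_neg_distrib]
  rw [neg_add, sub_eq_add_neg, add_comm]
  congr 2 <;> exact Finset.sum_congr rfl fun i _ => mul_comm _ _

/-- The lift of a change of coordinates to the cotangent bundle is symplectic. -/
theorem stdOmega_fderiv_cotangentLift {τ σ : Base n → Base n} {u : Base n} {ξ : Dual n}
    (hτ : DifferentiableAt ℝ τ u) (hσ : ContDiffAt ℝ ∞ σ (τ u)) (hστ : σ ∘ τ =ᶠ[𝓝 u] id)
    (v w : Base n × Dual n) :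
    stdOmega (fderiv ℝ (fun z : Base n × Dual n => (τ z.1, z.2 ∘L fderiv ℝ σ (τ z.1))) (u, ξ) v)
      (fderiv ℝ (fun z : Base n × Dual n => (τ z.1, z.2 ∘L fderiv ℝ σ (τ z.1))) (u, ξ) w)
      = stdOmega v w := by
  have hσ' : DifferentiableAt ℝ (fderiv ℝ σ) (τ u) :=
    (hσ.fderiv_right (m := 1) (by norm_cast)).differentiableAt (by norm_num)
  have hfst : HasFDerivAt (fun z : Base n × Dual n => τ z.1)
      (fderiv ℝ τ u ∘L ContinuousLinearMap.fst ℝ _ _) (u, ξ) :=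
    HasFDerivAt.comp (g := τ) (u, ξ) hτ.hasFDerivAt hasFDerivAt_fst
  have hM : HasFDerivAt (fun z : Base n × Dual n => fderiv ℝ σ (τ z.1))
      (fderiv ℝ (fderiv ℝ σ) (τ u) ∘L (fderiv ℝ τ u ∘L ContinuousLinearMap.fst ℝ _ _)) (u, ξ) :=
    HasFDerivAt.comp (g := fderiv ℝ σ) (u, ξ) hσ'.hasFDerivAt hfst
  have hsnd : HasFDerivAt (fun z : Base n × Dual n => z.2 ∘L fderiv ℝ σ (τ z.1)) _ (u, ξ) :=
    HasFDerivAt.clm_comp hasFDerivAt_snd hM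
  have hinv : ∀ a, fderiv ℝ σ (τ u) (fderiv ℝ τ u a) = a := by
    intro a
    have h1 : HasFDerivAt (σ ∘ τ) (fderiv ℝ σ (τ u) ∘L fderiv ℝ τ u) u :=
      (hσ.differentiableAt (by simp)).hasFDerivAt.comp u hτ.hasFDerivAt
    have h2 : HasFDerivAt (σ ∘ τ) (ContinuousLinearMap.id ℝ _) u :=
      (hasFDerivAt_id u).congr_of_eventuallyEq hστ
    exact DFunLike.congr_fun (h1.unique h2) a
  -- The first-order terms pair to the original form because σ inverts τ. What remains is ξ applied
  -- to the second derivative of σ, in both orders of its arguments, and symmetry cancels it.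
  have hsymm : IsSymmSndFDerivAt ℝ σ (τ u) := hσ.isSymmSndFDerivAt (by simp; exact WithTop.coe_le_coe.mpr le_top)
  rw [(hfst.prodMk hsnd).fderiv]
  simp only [stdOmega, ContinuousLinearMap.prod_apply, ContinuousLinearMap.comp_apply,
    add_apply, ContinuousLinearMap.compL_apply, ContinuousLinearMap.flip_apply,
    ContinuousLinearMap.coe_fst', ContinuousLinearMap.coe_snd', hinv]
  rw [hsymm.eq (fderiv ℝ τ u w.1) (fderiv ℝ τ u v.1)]
  ring

end Linear

variable {n : ℕ} {N : Type*} [TopologicalSpace N] [ChartedSpace (Base n) N]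
  [IsManifold (𝓡 n) ∞ N]

/-! ### Canonical charts of the cotangent bundle and regularity of Hamiltonian vector fields. -/

theorem cotangent_extChartAt_source (x : Cotangent n N) :
    (extChartAt (cotangentModel n) x).source = Bundle.TotalSpace.proj ⁻¹' (chartAt (Base n) x.proj).source := by
  rw [extChartAt_source, FiberBundle.chartedSpace_chartAt]
  simp only [mfld_simps]
  ext y
  simp only [mem_inter_iff, mem_preimage]
  constructor
  · rintro ⟨h, -⟩
    exact h.1
  · intro h
    refine ⟨⟨h, mem_univ _⟩, ?_⟩
    exact ⟨h, mem_univ _⟩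

/-- Covectors transform by precomposition, so the tangent coordinate change runs from the chart at
`x` to the one at `y`. This makes the bundle chart the canonical chart (q, p). -/
theorem cotangent_extChartAt_apply (x y : Cotangent n N)
    (hy : y.proj ∈ (chartAt (Base n) x.proj).source) :
    extChartAt (cotangentModel n) x y = (extChartAt (𝓡 n) x.proj y.proj,
      (y.2 : Dual n) ∘L tangentCoordChange (𝓡 n) x.proj y.proj y.proj) := by
  rw [FiberBundle.extChartAt]
  simp only [PartialEquiv.coe_trans, PartialEquiv.prod_coe, Function.comp]
  refine Prod.ext ?_ ?_
  · rfl
  · change (trivializationAt (Dual n)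
      (fun q : N => TangentSpace (𝓡 n) q →L[ℝ] Bundle.Trivial N ℝ q) x.proj y).2 = _
    rw [hom_trivializationAt_apply]
    simp only [ContinuousLinearMap.inCoordinates]
    rw [TangentBundle.symmL_trivializationAt_eq_core hy]
    ext v
    simp

/-- Brings chart transitions into the form of a cotangent lift, to which
`stdOmega_fderiv_cotangentLift` applies. -/
theorem cotangent_extChartAt_comp_symm_eventuallyEq (x y : Cotangent n N)
    (hy : y.proj ∈ (chartAt (Base n) x.proj).source) :
    extChartAt (cotangentModel n) x ∘ (extChartAt (cotangentModel n) y).symm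
      =ᶠ[𝓝 (extChartAt (cotangentModel n) y y)] fun z : Base n × Dual n =>
        ((extChartAt (𝓡 n) x.proj ∘ (extChartAt (𝓡 n) y.proj).symm) z.1,
          z.2 ∘L fderiv ℝ (extChartAt (𝓡 n) y.proj ∘ (extChartAt (𝓡 n) x.proj).symm)
            ((extChartAt (𝓡 n) x.proj ∘ (extChartAt (𝓡 n) y.proj).symm) z.1)) := by
  have h1 : (extChartAt (cotangentModel n) y).target ∈ 𝓝 (extChartAt (cotangentModel n) y y) :=
    extChartAt_target_mem_nhds y
  have h2 : (extChartAt (cotangentModel n) y).symm ⁻¹' (extChartAt (cotangentModel n) x).source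
      ∈ 𝓝 (extChartAt (cotangentModel n) y y) := by
    apply (continuousAt_extChartAt_symm y).preimage_mem_nhds
    rw [extChartAt_to_inv]
    refine (isOpen_extChartAt_source x).mem_nhds ?_
    rw [cotangent_extChartAt_source]
    exact hy
  filter_upwards [h1, h2] with p hp1 hp2
  set z := (extChartAt (cotangentModel n) y).symm p with hz
  have hzy : z ∈ (extChartAt (cotangentModel n) y).source :=
    (extChartAt (cotangentModel n) y).map_target hp1
  have hzx : z ∈ (extChartAt (cotangentModel n) x).source := hp2
  rw [cotangent_extChartAt_source] at hzy hzx
  have hp : extChartAt (cotangentModel n) y z = p :=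
    (extChartAt (cotangentModel n) y).right_inv hp1
  have hzy' : z.proj ∈ (extChartAt (𝓡 n) y.proj).source := by rw [extChartAt_source]; exact hzy
  have hzx' : z.proj ∈ (extChartAt (𝓡 n) x.proj).source := by rw [extChartAt_source]; exact hzx
  have hzz : z.proj ∈ (extChartAt (𝓡 n) z.proj).source := mem_extChartAt_source _
  change extChartAt (cotangentModel n) x z = _
  rw [← hp, cotangent_extChartAt_apply y z hzy, cotangent_extChartAt_apply x z hzx]
  simp only [Function.comp, (extChartAt (𝓡 n) y.proj).left_inv hzy']
  refine Prod.ext rfl ?_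
  have h3 : tangentCoordChange (𝓡 n) x.proj y.proj z.proj =
      fderiv ℝ (extChartAt (𝓡 n) y.proj ∘ (extChartAt (𝓡 n) x.proj).symm)
        (extChartAt (𝓡 n) x.proj z.proj) := by
    rw [tangentCoordChange_def, ModelWithCorners.range_eq_univ, fderivWithin_univ]
  refine ContinuousLinearMap.ext fun v => ?_
  change z.2 (tangentCoordChange (𝓡 n) x.proj z.proj z.proj v) = z.2 (tangentCoordChange (𝓡 n)
    y.proj z.proj z.proj (fderiv ℝ (extChartAt (𝓡 n) y.proj ∘ (extChartAt (𝓡 n) x.proj).symm)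
        (extChartAt (𝓡 n) x.proj z.proj) v))
  rw [← h3, tangentCoordChange_comp ⟨⟨hzx', hzy'⟩, hzz⟩]

/-- The coordinate changes between canonical charts are symplectic. -/
theorem stdOmega_tangentCoordChange (x y : Cotangent n N)
    (hy : y.proj ∈ (chartAt (Base n) x.proj).source) (v w : Base n × Dual n) :
    stdOmega (tangentCoordChange (cotangentModel n) y x y v)
      (tangentCoordChange (cotangentModel n) y x y w) = stdOmega v w := by
  have hy' : y.proj ∈ (extChartAt (𝓡 n) x.proj).source := by rw [extChartAt_source]; exact hy
  have hyy : y.proj ∈ (extChartAt (𝓡 n) y.proj).source := mem_extChartAt_source _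
  have e : tangentCoordChange (cotangentModel n) y x y = fderiv ℝ
      (extChartAt (cotangentModel n) x ∘ (extChartAt (cotangentModel n) y).symm)
      (extChartAt (cotangentModel n) y y) := by
    rw [tangentCoordChange_def, ModelWithCorners.range_eq_univ, fderivWithin_univ]
  have hpt : extChartAt (cotangentModel n) y y =
      (extChartAt (𝓡 n) y.proj y.proj, (extChartAt (cotangentModel n) y y).2) := by
    refine Prod.ext ?_ rfl
    rw [cotangent_extChartAt_apply y y (mem_chart_source _ _)]
  have hτ : ContDiffAt ℝ ∞ (extChartAt (𝓡 n) x.proj ∘ (extChartAt (𝓡 n) y.proj).symm)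
      (extChartAt (𝓡 n) y.proj y.proj) := by
    have := contDiffWithinAt_ext_coord_change (I := 𝓡 n) (n := ∞) x.proj y.proj
      (y := extChartAt (𝓡 n) y.proj y.proj) (by
        simp only [PartialEquiv.trans_source, PartialEquiv.symm_source, mem_inter_iff, mem_preimage]
        exact ⟨mem_extChartAt_target _, by rw [extChartAt_to_inv]; exact hy'⟩)
    rwa [ModelWithCorners.range_eq_univ, contDiffWithinAt_univ] at this
  have hσ : ContDiffAt ℝ ∞ (extChartAt (𝓡 n) y.proj ∘ (extChartAt (𝓡 n) x.proj).symm)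
      ((extChartAt (𝓡 n) x.proj ∘ (extChartAt (𝓡 n) y.proj).symm)
        (extChartAt (𝓡 n) y.proj y.proj)) := by
    have := contDiffWithinAt_ext_coord_change (I := 𝓡 n) (n := ∞) y.proj x.proj
      (y := extChartAt (𝓡 n) x.proj y.proj) (by
        simp only [PartialEquiv.trans_source, PartialEquiv.symm_source, mem_inter_iff, mem_preimage]
        exact ⟨(extChartAt (𝓡 n) x.proj).map_source hy',
          by rw [(extChartAt (𝓡 n) x.proj).left_inv hy']; exact hyy⟩)
    rw [ModelWithCorners.range_eq_univ, contDiffWithinAt_univ] at this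
    rwa [Function.comp_apply, extChartAt_to_inv]
  have hστ : (extChartAt (𝓡 n) y.proj ∘ (extChartAt (𝓡 n) x.proj).symm) ∘
      (extChartAt (𝓡 n) x.proj ∘ (extChartAt (𝓡 n) y.proj).symm)
      =ᶠ[𝓝 (extChartAt (𝓡 n) y.proj y.proj)] id := by
    have h1 : (extChartAt (𝓡 n) y.proj).target ∈ 𝓝 (extChartAt (𝓡 n) y.proj y.proj) :=
      extChartAt_target_mem_nhds y.proj
    have h2 : (extChartAt (𝓡 n) y.proj).symm ⁻¹' (extChartAt (𝓡 n) x.proj).source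
        ∈ 𝓝 (extChartAt (𝓡 n) y.proj y.proj) := by
      apply (continuousAt_extChartAt_symm y.proj).preimage_mem_nhds
      rw [extChartAt_to_inv]
      exact (isOpen_extChartAt_source x.proj).mem_nhds hy'
    filter_upwards [h1, h2] with p hp1 hp2
    simp only [Function.comp, id]
    rw [(extChartAt (𝓡 n) x.proj).left_inv hp2, (extChartAt (𝓡 n) y.proj).right_inv hp1]
  rw [e, (cotangent_extChartAt_comp_symm_eventuallyEq x y hy).fderiv_eq, hpt]
  exact stdOmega_fderiv_cotangentLift (hτ.differentiableAt (by simp)) hσ hστ v w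

/-- The Hamiltonian vector field in a canonical chart. -/
theorem tangentCoordChange_hamVF {F : Cotangent n N → ℝ} (hF : IsSmooth F) (x y : Cotangent n N)
    (hy : y.proj ∈ (chartAt (Base n) x.proj).source) :
    tangentCoordChange (cotangentModel n) y x y (hamVF F y) =
      omegaSharp (fderiv ℝ (F ∘ (extChartAt (cotangentModel n) x).symm)
        (extChartAt (cotangentModel n) x y)) := by
  have hyx : y ∈ (extChartAt (cotangentModel n) x).source := by
    rw [cotangent_extChartAt_source]; exact hy
  have hyy : y ∈ (extChartAt (cotangentModel n) y).source := mem_extChartAt_source _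
  have e : HasFDerivAt (extChartAt (cotangentModel n) x ∘ (extChartAt (cotangentModel n) y).symm)
      (tangentCoordChange (cotangentModel n) y x y) (extChartAt (cotangentModel n) y y) := by
    have := hasFDerivWithinAt_tangentCoordChange (I := cotangentModel n) ⟨hyy, hyx⟩
    rwa [ModelWithCorners.range_eq_univ, hasFDerivWithinAt_univ] at this
  -- By nondegeneracy it suffices to check the equation defining X_F. The coordinate change is
  -- symplectic and onto, so it may be checked on transported vectors.
  refine stdOmega_left_ext fun w => ?_
  obtain ⟨w', rfl⟩ : ∃ w', w = tangentCoordChange (cotangentModel n) y x y w' := by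
    refine ⟨tangentCoordChange (cotangentModel n) x y y w, ?_⟩
    rw [tangentCoordChange_comp ⟨⟨hyx, hyy⟩, hyx⟩, tangentCoordChange_self hyx]
  refine (stdOmega_tangentCoordChange x y hy (hamVF F y) w').trans ?_
  rw [stdOmega_omegaSharp]
  have h1 : stdOmega (hamVF F y) w' = -differential F y w' := (eq_hamVF_iff F y _).mp rfl w'
  rw [h1]
  congr 1
  have hFx : DifferentiableAt ℝ (F ∘ (extChartAt (cotangentModel n) x).symm)
      (extChartAt (cotangentModel n) x y) := by
    have h2 : MDifferentiableAt (cotangentModel n) 𝓘(ℝ, ℝ) F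
        ((extChartAt (cotangentModel n) x).symm (extChartAt (cotangentModel n) x y)) :=
      (hF _).mdifferentiableAt (by simp)
    have h3 : MDifferentiableAt 𝓘(ℝ, Base n × Dual n) (cotangentModel n)
        (extChartAt (cotangentModel n) x).symm (extChartAt (cotangentModel n) x y) := by
      have := mdifferentiableWithinAt_extChartAt_symm (I := cotangentModel n)
        ((extChartAt (cotangentModel n) x).map_source hyx)
      rwa [ModelWithCorners.range_eq_univ, mdifferentiableWithinAt_univ] at this
    exact (h2.comp _ h3).differentiableAt
  have h4 : differential F y w' = fderiv ℝ (F ∘ (extChartAt (cotangentModel n) y).symm)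
      (extChartAt (cotangentModel n) y y) w' := by
    change mfderiv (cotangentModel n) 𝓘(ℝ, ℝ) F y w' = _
    rw [((hF y).mdifferentiableAt (by simp)).mfderiv,
      ModelWithCorners.range_eq_univ, fderivWithin_univ]
    rfl
  have h5 : F ∘ (extChartAt (cotangentModel n) y).symm =ᶠ[𝓝 (extChartAt (cotangentModel n) y y)]
      (F ∘ (extChartAt (cotangentModel n) x).symm) ∘
        (extChartAt (cotangentModel n) x ∘ (extChartAt (cotangentModel n) y).symm) := by
    have h2 : (extChartAt (cotangentModel n) y).symm ⁻¹' (extChartAt (cotangentModel n) x).source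
        ∈ 𝓝 (extChartAt (cotangentModel n) y y) := by
      apply (continuousAt_extChartAt_symm y).preimage_mem_nhds
      rw [extChartAt_to_inv]
      exact (isOpen_extChartAt_source x).mem_nhds hyx
    filter_upwards [h2] with p hp
    simp only [Function.comp]
    rw [(extChartAt (cotangentModel n) x).left_inv hp]
  have h6 : (extChartAt (cotangentModel n) x ∘ (extChartAt (cotangentModel n) y).symm)
      (extChartAt (cotangentModel n) y y) = extChartAt (cotangentModel n) x y := by
    rw [Function.comp_apply, extChartAt_to_inv]
  rw [h4, h5.fderiv_eq]
  have h7 := HasFDerivAt.comp (extChartAt (cotangentModel n) y y)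
    (by rw [h6]; exact hFx.hasFDerivAt) e
  rw [h7.fderiv]
  rfl

theorem contDiffAt_clm_fderiv {E W : Type*} [NormedAddCommGroup E] [NormedSpace ℝ E]
    [NormedAddCommGroup W] [NormedSpace ℝ W] (L : (E →L[ℝ] ℝ) →L[ℝ] W) {f : E → ℝ} {x : E}
    (hf : ContDiffAt ℝ ∞ f x) : ContDiffAt ℝ 1 (fun z => L (fderiv ℝ f z)) x :=
  L.contDiff.contDiffAt.comp x (hf.fderiv_right (m := 1) (by norm_cast))

set_option synthInstance.maxHeartbeats 400000 in
/-- The Hamiltonian vector field of a smooth function is `C¹`. -/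
theorem contMDiff_hamVF {F : Cotangent n N → ℝ} (hF : IsSmooth F) :
    ContMDiff (cotangentModel n) (cotangentModel n).tangent 1
      (fun x => (⟨x, hamVF F x⟩ : TangentBundle (cotangentModel n) (Cotangent n N))) := by
  intro x
  rw [Bundle.contMDiffAt_section]
  have hF' : ContDiffAt ℝ ∞ (F ∘ (extChartAt (cotangentModel n) x).symm)
      (extChartAt (cotangentModel n) x x) := by
    have := (contMDiffAt_iff.mp (hF x)).2
    rw [ModelWithCorners.range_eq_univ, contDiffWithinAt_univ] at this
    exact this
  have hG : ContDiffAt ℝ 1 (fun z => omegaSharp (n := n) (fderiv ℝ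
      (F ∘ (extChartAt (cotangentModel n) x).symm) z)) (extChartAt (cotangentModel n) x x) :=
    contDiffAt_clm_fderiv omegaSharp hF'
  have h1 : ContMDiffAt (cotangentModel n) 𝓘(ℝ, Base n × Dual n) 1 (fun y => omegaSharp (n := n)
      (fderiv ℝ (F ∘ (extChartAt (cotangentModel n) x).symm)
        (extChartAt (cotangentModel n) x y))) x :=
    hG.contMDiffAt.comp x (contMDiffAt_extChartAt (n := 1))
  refine h1.congr_of_eventuallyEq ?_
  have h2 : (extChartAt (cotangentModel n) x).source ∈ 𝓝 x := extChartAt_source_mem_nhds x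
  rw [cotangent_extChartAt_source] at h2
  filter_upwards [h2] with y hy
  exact tangentCoordChange_hamVF hF x y hy

/-- Points in one fibre share a chart; points in different fibres are separated in the base. The
flow construction and the uniqueness of integral curves use this. -/
instance cotangent_t2Space [T2Space N] : T2Space (Cotangent n N) := by
  refine ⟨fun x y hxy => ?_⟩
  have hc : Continuous (Bundle.TotalSpace.proj : Cotangent n N → N) :=
    (Bundle.contMDiff_proj (n := 0) (IB := 𝓡 n) _).continuous
  by_cases h : x.proj = y.proj
  · have hx : x ∈ (extChartAt (cotangentModel n) x).source := mem_extChartAt_source _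
    have hy : y ∈ (extChartAt (cotangentModel n) x).source := by
      rw [cotangent_extChartAt_source, mem_preimage, ← h]
      exact mem_chart_source _ _
    have hne : extChartAt (cotangentModel n) x x ≠ extChartAt (cotangentModel n) x y :=
      fun he => hxy ((extChartAt (cotangentModel n) x).injOn hx hy he)
    obtain ⟨U, V, hU, hV, hxU, hyV, hUV⟩ := t2_separation hne
    refine ⟨_, _, (continuousOn_extChartAt x).isOpen_inter_preimage (isOpen_extChartAt_source x) hU,
      (continuousOn_extChartAt x).isOpen_inter_preimage (isOpen_extChartAt_source x) hV,
      ⟨hx, hxU⟩, ⟨hy, hyV⟩, ?_⟩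
    exact (hUV.preimage _).mono inter_subset_right inter_subset_right
  · obtain ⟨U, V, hU, hV, hxU, hyV, hUV⟩ := t2_separation h
    exact ⟨_, _, hU.preimage hc, hV.preimage hc, hxU, hyV, hUV.preimage _⟩

instance cotangent_locallyCompactSpace : LocallyCompactSpace (Cotangent n N) :=
  Manifold.locallyCompact_of_finiteDimensional (cotangentModel n)

/-! ### Smooth functions with finitely many critical points. -/

section Generic

variable {J : Type*} [Fintype J]

/-- The bad parameters are the projection, along the compact factor `K`, of a closed set, hence
closed. -/
theorem isOpen_setOf_nondegenerate {E : Type*} [NormedAddCommGroup E] [NormedSpace ℝ E]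
    {γ : J → E → E} {Ω K : Set E} (hΩ : IsOpen Ω) (hγ : ∀ j, ContDiffOn ℝ 1 (γ j) Ω)
    (hK : IsCompact K) (hKΩ : K ⊆ Ω) :
    IsOpen {a : J → ℝ | ∀ x ∈ K, ∑ j, a j • γ j x = 0 →
      (∑ j, a j • fderiv ℝ (γ j) x).det ≠ 0} := by
  have : CompactSpace K := isCompact_iff_compactSpace.mp hK
  have hc : ∀ j, Continuous fun p : (J → ℝ) × K => γ j p.2 := fun j =>
    ((hγ j).continuousOn.mono hKΩ).domRestrict.comp continuous_snd
  have hd : ∀ j, Continuous fun p : (J → ℝ) × K => fderiv ℝ (γ j) p.2 := fun j =>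
    ((((hγ j).fderiv_of_isOpen hΩ (m := 0) (by simp)).continuousOn).mono hKΩ).domRestrict.comp
      continuous_snd
  have ha : ∀ j, Continuous fun p : (J → ℝ) × K => p.1 j := fun j =>
    (continuous_apply j).comp continuous_fst
  have hS : IsClosed {p : (J → ℝ) × K | ∑ j, p.1 j • γ j p.2 = 0 ∧
      (∑ j, p.1 j • fderiv ℝ (γ j) p.2).det = 0} := by
    refine IsClosed.inter (isClosed_eq ?_ continuous_const) (isClosed_eq ?_ continuous_const)
    · exact continuous_finsetSum _ fun j _ => (ha j).smul (hc j)
    · exact ContinuousLinearMap.continuous_det.comp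
        (continuous_finsetSum _ fun j _ => (ha j).smul (hd j))
  rw [← isClosed_compl_iff]
  convert isClosedMap_fst_of_compactSpace _ hS using 1
  ext a
  simp only [mem_compl_iff, mem_ofPred_eq, mem_image, Prod.exists, Subtype.exists]
  push Not
  constructor
  · rintro ⟨x, hx, h1, h2⟩
    exact ⟨a, x, hx, ⟨h1, h2⟩, rfl⟩
  · rintro ⟨a, x, hx, ⟨h1, h2⟩, rfl⟩
    exact ⟨x, hx, h1, h2⟩

/-- A parametric Sard argument. On `O` the fields `γ (e k)` are the constant basis, so lowering
their coefficients by c subtracts c from the sum and leaves its derivative alone. A degenerate zero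
of the shifted field then exhibits c as a critical value of the unshifted one, and critical values
form a null set. -/
theorem dense_setOf_nondegenerate {n : ℕ}
    {γ : J → Base n → Base n} {Ω O K : Set (Base n)} (hΩ : IsOpen Ω)
    (hγ : ∀ j, ContDiffOn ℝ 1 (γ j) Ω) (hO : IsOpen O) (hKΩ : K ⊆ Ω) (hKO : K ⊆ O)
    (e : Fin n → J) (he : ∀ k, ∀ x ∈ O, γ (e k) x = EuclideanSpace.single k (1 : ℝ)) :
    Dense {a : J → ℝ | ∀ x ∈ K, ∑ j, a j • γ j x = 0 →
      (∑ j, a j • fderiv ℝ (γ j) x).det ≠ 0} := by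
  classical
  intro a
  have hdiff : ∀ x ∈ K, HasFDerivAt (fun x => ∑ j, a j • γ j x)
      (∑ j, a j • fderiv ℝ (γ j) x) x := by
    intro x hx
    refine HasFDerivAt.fun_sum fun j _ => HasFDerivAt.fun_const_smul ?_ _
    exact (((hγ j).contDiffAt (hΩ.mem_nhds (hKΩ hx))).differentiableAt (by simp)).hasFDerivAt
  set C : Set (Base n) := {x ∈ K | (∑ j, a j • fderiv ℝ (γ j) x).det = 0} with hC
  have hnull : MeasureTheory.volume ((fun x => ∑ j, a j • γ j x) '' C) = 0 :=
    MeasureTheory.addHaar_image_eq_zero_of_det_fderivWithin_eq_zero _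
      (fun x hx => (hdiff x hx.1).hasFDerivWithinAt) (fun x hx => hx.2)
  have hdense : Dense {c : Base n | c ∉ (fun x => ∑ j, a j • γ j x) '' C} := by
    refine MeasureTheory.Measure.dense_of_ae (μ := MeasureTheory.volume) ?_
    exact MeasureTheory.measure_eq_zero_iff_ae_notMem.mp hnull
  set L : Base n → J → ℝ := fun c j => a j - ∑ k, c k * (Pi.single (e k) (1 : ℝ) : J → ℝ) j with hL
  have hLc : Continuous L := by
    refine continuous_pi fun j => continuous_const.sub ?_
    exact continuous_finsetSum _ fun k _ => (EuclideanSpace.proj k).continuous.mul continuous_const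
  have hL0 : L 0 = a := by ext j; simp [hL]
  have hsum : ∀ {F : Type} [AddCommGroup F] [Module ℝ F] (c : Base n) (v : J → F),
      ∑ j, L c j • v j = ∑ j, a j • v j - ∑ k, c k • v (e k) := by
    intro F _ _ c v
    simp only [hL, sub_smul, Finset.sum_sub_distrib, Finset.sum_smul]
    congr 1
    rw [Finset.sum_comm]
    refine Finset.sum_congr rfl fun k _ => ?_
    rw [Finset.sum_eq_single (e k)]
    · simp
    · intro j _ hj
      simp [Pi.single_eq_of_ne hj]
    · simp
  have hmem : L '' {c : Base n | c ∉ (fun x => ∑ j, a j • γ j x) '' C} ⊆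
      {a : J → ℝ | ∀ x ∈ K, ∑ j, a j • γ j x = 0 →
        (∑ j, a j • fderiv ℝ (γ j) x).det ≠ 0} := by
    rintro _ ⟨c, hc, rfl⟩ x hx h0 hdet
    rw [hsum] at h0
    rw [show ∑ j, L c j • fderiv ℝ (γ j) x = _ from hsum c fun j => fderiv ℝ (γ j) x] at hdet
    have hcs : ∑ k, c k • γ (e k) x = c := by
      ext i
      simp [he _ x (hKO hx), Pi.single_apply]
    have hfs : ∑ k, c k • fderiv ℝ (γ (e k)) x = 0 := by
      refine Finset.sum_eq_zero fun k _ => ?_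
      have : γ (e k) =ᶠ[𝓝 x] fun _ => EuclideanSpace.single k (1 : ℝ) := by
        filter_upwards [hO.mem_nhds (hKO hx)] with y hy using he k y hy
      rw [this.fderiv_eq, fderiv_fun_const]
      exact smul_zero (A := Base n →L[ℝ] Base n) (c k : ℝ)
    rw [hcs, sub_eq_zero] at h0
    rw [hfs, sub_zero] at hdet
    exact hc ⟨x, ⟨hx, hdet⟩, h0⟩
  rw [← hL0]
  exact closure_mono hmem (image_closure_subset_closure_image hLc ⟨0, hdense 0, rfl⟩)

/-- Infinitely many zeros would accumulate in `K`, at a zero by continuity, but an injective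
derivative isolates that zero. -/
theorem finite_zeros_of_nondegenerate {E : Type*} [NormedAddCommGroup E] [NormedSpace ℝ E]
    [FiniteDimensional ℝ E] {Ψ : E → E} {Ψ' : E → E →L[ℝ] E} {K : Set E} (hK : IsCompact K)
    (hΨ : ∀ x ∈ K, HasFDerivAt Ψ (Ψ' x) x) (hdet : ∀ x ∈ K, Ψ x = 0 → (Ψ' x).det ≠ 0) :
    {x ∈ K | Ψ x = 0}.Finite := by
  by_contra hinf
  obtain ⟨z, hzK, hz⟩ := Set.Infinite.exists_accPt_of_subset_isCompact hinf hK (sep_subset _ _)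
  rw [accPt_iff_frequently] at hz
  have hz0 : Ψ z = 0 := by
    by_contra h
    have h1 : ∀ᶠ y in 𝓝 z, Ψ y ≠ 0 := (hΨ z hzK).continuousAt.eventually_ne h
    obtain ⟨y, ⟨-, hy⟩, hy'⟩ := (hz.and_eventually h1).exists
    exact hy' hy.2
  have hinj : Injective (Ψ' z) := by
    have hu : IsUnit (LinearMap.det (Ψ' z : E →ₗ[ℝ] E)) := isUnit_iff_ne_zero.mpr (hdet z hzK hz0)
    have := (LinearMap.equivOfDetNeZero (Ψ' z : E →ₗ[ℝ] E) hu.ne_zero).injective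
    exact this
  have hker : (Ψ' z : E →ₗ[ℝ] E).ker = ⊥ := LinearMap.ker_eq_bot.mpr hinj
  obtain ⟨C, -, hC⟩ := (Ψ' z : E →ₗ[ℝ] E).exists_antilipschitzWith hker
  have h1 : ∀ᶠ y in 𝓝[≠] z, Ψ y ≠ 0 := (hΨ z hzK).eventually_ne ⟨C, hC⟩
  rw [eventually_nhdsWithin_iff] at h1
  obtain ⟨y, ⟨hy1, hy⟩, hy'⟩ := (hz.and_eventually h1).exists
  exact hy' hy1 hy.2

end Generic

/-- The gradient in standard coordinates. -/
def coordGrad {n : ℕ} : Dual n →L[ℝ] Base n :=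
  ∑ k : Fin n, (ContinuousLinearMap.apply ℝ ℝ (EuclideanSpace.single k (1 : ℝ) : Base n)).smulRight
    (EuclideanSpace.single k (1 : ℝ))

theorem coordGrad_proj {n : ℕ} (k : Fin n) :
    coordGrad (EuclideanSpace.proj k : Dual n) = EuclideanSpace.single k (1 : ℝ) := by
  ext i
  simp [coordGrad, sum_apply]

/-- The chain rule. Which `A` occurs is irrelevant: the factorization shows that the chart
derivative vanishes at a critical point. -/
theorem hasFDerivAt_comp_extChartAt_symm {f : N → ℝ} (hf : ContMDiff (𝓡 n) 𝓘(ℝ, ℝ) ∞ f) {c x : N}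
    (hx : x ∈ (extChartAt (𝓡 n) c).source) :
    ∃ A : Base n →L[ℝ] TangentSpace (𝓡 n) x, HasFDerivAt (f ∘ (extChartAt (𝓡 n) c).symm)
      ((mfderiv (𝓡 n) 𝓘(ℝ, ℝ) f x : TangentSpace (𝓡 n) x →L[ℝ] ℝ) ∘L A)
      (extChartAt (𝓡 n) c x) := by
  have h3 : MDifferentiableAt 𝓘(ℝ, Base n) (𝓡 n)
      (extChartAt (𝓡 n) c).symm (extChartAt (𝓡 n) c x) := by
    have := mdifferentiableWithinAt_extChartAt_symm (I := 𝓡 n)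
      ((extChartAt (𝓡 n) c).map_source hx)
    rwa [ModelWithCorners.range_eq_univ, mdifferentiableWithinAt_univ] at this
  have hl := (extChartAt (𝓡 n) c).left_inv hx
  have h2 : HasMFDerivAt (𝓡 n) 𝓘(ℝ, ℝ) f ((extChartAt (𝓡 n) c).symm (extChartAt (𝓡 n) c x))
      (mfderiv (𝓡 n) 𝓘(ℝ, ℝ) f ((extChartAt (𝓡 n) c).symm (extChartAt (𝓡 n) c x))) :=
    ((hf _).mdifferentiableAt (by simp)).hasMFDerivAt
  have h4 := (h2.comp _ h3.hasMFDerivAt).hasFDerivAt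
  rw [hl] at h4
  exact ⟨mfderiv 𝓘(ℝ, Base n) (𝓡 n) (extChartAt (𝓡 n) c).symm (extChartAt (𝓡 n) c x), h4⟩

/-- Every closed manifold carries a smooth function with finitely many critical points. -/
theorem exists_contMDiff_finite_critical (N : Type*) [TopologicalSpace N] [ChartedSpace (Base n) N]
    [IsManifold (𝓡 n) ∞ N] [T2Space N] [CompactSpace N] :
    ∃ f : N → ℝ, ContMDiff (𝓡 n) 𝓘(ℝ, ℝ) ∞ f ∧
      {x | mfderiv (𝓡 n) 𝓘(ℝ, ℝ) f x = 0}.Finite := by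
  classical
  have b : ∀ c : N, SmoothBumpFunction (𝓡 n) c := fun c => Classical.arbitrary _
  set W : N → Set N := fun c => (extChartAt (𝓡 n) c).source ∩
    extChartAt (𝓡 n) c ⁻¹' Metric.ball (extChartAt (𝓡 n) c c) ((b c).rIn / 2) with hW
  have hWnhds : ∀ c, W c ∈ 𝓝 c := fun c => Filter.inter_mem (extChartAt_source_mem_nhds c)
    ((continuousAt_extChartAt c).preimage_mem_nhds
      (Metric.ball_mem_nhds _ (half_pos (b c).rIn_pos)))
  obtain ⟨t, ht⟩ := CompactSpace.elim_nhds_subcover W hWnhds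
  -- Cut-off coordinates. Around the centre of each chart of the finite cover their gradients are
  -- the standard basis, as the density lemma requires; the half-radius balls leave room for this
  -- around `K`.
  set G : t × Fin n → N → ℝ := fun j x => b j.1 x * (extChartAt (𝓡 n) (j.1 : N) x) j.2 with hG
  have hGs : ∀ j, ContMDiff (𝓡 n) 𝓘(ℝ, ℝ) ∞ (G j) := by
    intro j
    refine (b j.1).contMDiff_smul (g := fun x => (extChartAt (𝓡 n) (j.1 : N) x) j.2) ?_
    exact (EuclideanSpace.proj (𝕜 := ℝ) j.2).contMDiff.comp_contMDiffOn contMDiffOn_extChartAt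
  set Ω : t → Set (Base n) := fun i => (extChartAt (𝓡 n) (i : N)).target with hΩ
  have hΩo : ∀ i, IsOpen (Ω i) := fun i => isOpen_extChartAt_target _
  set O : t → Set (Base n) := fun i =>
    Metric.ball (extChartAt (𝓡 n) (i : N) i) (b i).rIn with hO
  set K : t → Set (Base n) := fun i =>
    Metric.closedBall (extChartAt (𝓡 n) (i : N) i) ((b i).rIn / 2) with hK
  have hKO : ∀ i, K i ⊆ O i := fun i =>
    Metric.closedBall_subset_ball (half_lt_self (b i).rIn_pos)
  have hOΩ : ∀ i, O i ⊆ Ω i := by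
    intro i x hx
    apply (b i).ball_subset
    rw [ModelWithCorners.range_eq_univ, inter_univ]
    exact Metric.ball_subset_ball (b i).rIn_lt_rOut.le hx
  set g : t → t × Fin n → Base n → ℝ := fun i j => G j ∘ (extChartAt (𝓡 n) (i : N)).symm with hg
  have hgs : ∀ i j, ContDiffOn ℝ ∞ (g i j) (Ω i) := by
    intro i j
    rw [← contMDiffOn_iff_contDiffOn]
    exact (hGs j).comp_contMDiffOn (contMDiffOn_extChartAt_symm _)
  set γ : t → t × Fin n → Base n → Base n := fun i j x => coordGrad (fderiv ℝ (g i j) x) with hγ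
  have hγs : ∀ i j, ContDiffOn ℝ 1 (γ i j) (Ω i) := fun i j =>
    coordGrad.contDiff.comp_contDiffOn ((hgs i j).fderiv_of_isOpen (hΩo i) (by norm_cast))
  have hγe : ∀ i, ∀ k, ∀ x ∈ O i, γ i (i, k) x = EuclideanSpace.single k (1 : ℝ) := by
    intro i k x hx
    have h1 : g i (i, k) =ᶠ[𝓝 x] (EuclideanSpace.proj k : Dual n) := by
      filter_upwards [Metric.isOpen_ball.mem_nhds hx] with y hy
      have hyΩ := hOΩ i hy
      have hys := (extChartAt (𝓡 n) (i : N)).map_target hyΩ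
      have hyr := (extChartAt (𝓡 n) (i : N)).right_inv hyΩ
      simp only [hg, hG, Function.comp]
      rw [(b i).one_of_dist_le (by rwa [extChartAt_source] at hys)
        (by rw [hyr]; exact (Metric.mem_ball.mp hy).le), hyr]
      simp
    simp only [hγ]
    rw [h1.fderiv_eq, ContinuousLinearMap.fderiv, coordGrad_proj]
  obtain ⟨a, ha⟩ : ∃ a : t × Fin n → ℝ, ∀ i, ∀ x ∈ K i, ∑ j, a j • γ i j x = 0 →
      (∑ j, a j • fderiv ℝ (γ i j) x).det ≠ 0 := by
    -- One parameter has to serve every chart of the finite cover; openness together with density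
    -- lets the good sets be intersected.
    have hd := dense_iInter_of_isOpen
      (fun i => isOpen_setOf_nondegenerate (hΩo i) (hγs i) (isCompact_closedBall _ _)
        ((hKO i).trans (hOΩ i)))
      (fun i => dense_setOf_nondegenerate (hΩo i) (hγs i) Metric.isOpen_ball
        ((hKO i).trans (hOΩ i)) (hKO i) (fun k => (i, k)) (hγe i))
    obtain ⟨a, ha⟩ := hd.nonempty
    exact ⟨a, fun i => mem_iInter.mp ha i⟩
  set f : N → ℝ := fun x => ∑ j, a j * G j x with hf
  have hfs : ContMDiff (𝓡 n) 𝓘(ℝ, ℝ) ∞ f :=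
    contMDiff_finsetSum fun j _ => contMDiff_const.mul (hGs j)
  refine ⟨f, hfs, ?_⟩
  have hfin : ∀ i : t, {x ∈ K i | ∑ j, a j • γ i j x = 0}.Finite := by
    intro i
    refine finite_zeros_of_nondegenerate (isCompact_closedBall _ _) (fun x hx => ?_) (ha i)
    refine HasFDerivAt.fun_sum fun j _ => HasFDerivAt.fun_const_smul ?_ _
    exact (((hγs i j).contDiffAt ((hΩo i).mem_nhds (hOΩ i (hKO i hx)))).differentiableAt
      (by simp)).hasFDerivAt
  refine (finite_iUnion fun i : t => (hfin i).image (extChartAt (𝓡 n) (i : N)).symm).subset ?_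
  intro x hx
  have hx0 : mfderiv (𝓡 n) 𝓘(ℝ, ℝ) f x = 0 := hx
  obtain ⟨c, hc, hxc⟩ : ∃ c ∈ t, x ∈ W c := by
    have : x ∈ ⋃ c ∈ t, W c := by rw [ht]; trivial
    simpa using this
  refine mem_iUnion.mpr ⟨⟨c, hc⟩, extChartAt (𝓡 n) c x, ⟨?_, ?_⟩, ?_⟩
  · exact Metric.ball_subset_closedBall hxc.2
  · obtain ⟨A, hA⟩ := hasFDerivAt_comp_extChartAt_symm hfs hxc.1
    rw [hx0] at hA
    have hxK : extChartAt (𝓡 n) c x ∈ Ω ⟨c, hc⟩ := (extChartAt (𝓡 n) c).map_source hxc.1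
    have hA' : HasFDerivAt (f ∘ (extChartAt (𝓡 n) c).symm)
        (∑ j, a j • fderiv ℝ (g ⟨c, hc⟩ j) (extChartAt (𝓡 n) c x)) (extChartAt (𝓡 n) c x) := by
      have : f ∘ (extChartAt (𝓡 n) c).symm = fun y => ∑ j, a j • g ⟨c, hc⟩ j y := by
        funext y
        simp [hf, hg]
      rw [this]
      refine HasFDerivAt.fun_sum fun j _ => HasFDerivAt.fun_const_smul ?_ _
      exact (((hgs ⟨c, hc⟩ j).contDiffAt ((hΩo ⟨c, hc⟩).mem_nhds hxK)).differentiableAt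
        (by simp)).hasFDerivAt
    have h0 := hA'.unique hA
    have hz : ((0 : TangentSpace (𝓡 n) x →L[ℝ] ℝ) ∘L A) = (0 : Dual n) :=
      ContinuousLinearMap.zero_comp A
    have h1 := congrArg coordGrad (h0.trans hz)
    rw [map_sum, map_zero] at h1
    simpa only [map_smul] using h1
  · exact (extChartAt (𝓡 n) c).left_inv hxc.1

/-! ### Moving critical points by compactly supported expansions. -/

/-- A diffeomorphism of a vector space, supported in a ball and expanding a smaller ball. -/
theorem exists_radial_expansion {E : Type*} [NormedAddCommGroup E] [InnerProductSpace ℝ E]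
    [FiniteDimensional ℝ E] (w : E) {r' r : ℝ} (hr' : 0 < r') (hr : r' < r) :
    ∃ ε > (0 : ℝ), ∃ ρ : E → E, ContDiff ℝ ∞ ρ ∧ Injective ρ ∧
      (∀ z, Surjective (fderiv ℝ ρ z)) ∧ (∀ z ∉ Metric.ball w r, ρ z = z) ∧
      ∀ z ∈ Metric.closedBall w r', ρ z = w + (1 + ε) • (z - w) := by
  set b : ContDiffBump w := ⟨r', r, hr', hr⟩ with hb
  set h : E → E := fun z => b z • (z - w) with hh
  have hs : ContDiff ℝ ∞ h := b.contDiff.smul (contDiff_id.sub contDiff_const)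
  have hcs : HasCompactSupport h := b.hasCompactSupport.smul_right
  obtain ⟨C, hC⟩ := hs.lipschitzWith_of_hasCompactSupport hcs (by simp)
  -- This makes `ε • h` Lipschitz with constant at most 1/2, so adding it to the identity keeps the
  -- map injective and its derivative invertible.
  set ε : ℝ := 1 / (2 * (C + 1)) with hε
  have hCpos : (0 : ℝ) < C + 1 := by positivity
  have hεpos : 0 < ε := by positivity
  have hεC : ε * C ≤ 1 / 2 := by
    rw [hε, div_mul_eq_mul_div, div_le_iff₀ (by positivity)]
    linarith
  have hhd : ∀ z, HasFDerivAt h (fderiv ℝ h z) z := fun z =>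
    (hs.differentiable (by simp) z).hasFDerivAt
  refine ⟨ε, hεpos, fun z => z + ε • h z, contDiff_id.add (contDiff_const.smul hs), ?_, ?_, ?_, ?_⟩
  · intro z z' hzz
    have h1 : z - z' = ε • (h z' - h z) := by
      have : z + ε • h z = z' + ε • h z' := hzz
      rw [smul_sub, sub_eq_sub_iff_add_eq_add, this, add_comm]
    have h2 : ‖z - z'‖ ≤ 1 / 2 * ‖z - z'‖ := by
      calc ‖z - z'‖ = ε * ‖h z' - h z‖ := by
            conv_lhs => rw [h1]
            rw [norm_smul, Real.norm_of_nonneg hεpos.le]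
        _ ≤ ε * (C * ‖z' - z‖) := by
            gcongr
            exact hC.norm_sub_le _ _
        _ = ε * C * ‖z - z'‖ := by rw [norm_sub_rev]; ring
        _ ≤ 1 / 2 * ‖z - z'‖ := by gcongr
    have h3 : ‖z - z'‖ = 0 := by linarith [norm_nonneg (z - z')]
    exact sub_eq_zero.mp (norm_eq_zero.mp h3)
  · intro z
    have h1 : HasFDerivAt (fun z => z + ε • h z)
        (ContinuousLinearMap.id ℝ E + ε • fderiv ℝ h z) z :=
      (hasFDerivAt_id z).add ((hhd z).fun_const_smul ε)
    rw [h1.fderiv]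
    have hinj : Injective (ContinuousLinearMap.id ℝ E + ε • fderiv ℝ h z : E →L[ℝ] E) := by
      rw [injective_iff_map_eq_zero]
      intro v hv
      have h2 : v = -(ε • fderiv ℝ h z v) := by
        rw [eq_neg_iff_add_eq_zero]
        simpa using hv
      have h3 : ‖v‖ ≤ 1 / 2 * ‖v‖ := by
        calc ‖v‖ = ε * ‖fderiv ℝ h z v‖ := by
              conv_lhs => rw [h2]
              rw [norm_neg, norm_smul, Real.norm_of_nonneg hεpos.le]
          _ ≤ ε * (C * ‖v‖) := by
              gcongr
              exact (ContinuousLinearMap.le_opNorm _ _).trans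
                (mul_le_mul_of_nonneg_right (norm_fderiv_le_of_lipschitz ℝ hC) (norm_nonneg _))
          _ = ε * C * ‖v‖ := by ring
          _ ≤ 1 / 2 * ‖v‖ := by gcongr
      have h4 : ‖v‖ = 0 := by linarith [norm_nonneg v]
      exact norm_eq_zero.mp h4
    exact LinearMap.surjective_of_injective
      (f := (ContinuousLinearMap.id ℝ E + ε • fderiv ℝ h z : E →L[ℝ] E).toLinearMap) hinj
  · intro z hz
    have : b z = 0 := b.zero_of_le_dist (by simpa using hz)
    simp [hh, this]
  · intro z hz
    have : b z = 1 := b.one_of_mem_closedBall hz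
    simp only [hh, this, one_smul, add_smul]
    abel

end CotangentQS

namespace CotangentQS

variable {n : ℕ} {N : Type*} [TopologicalSpace N] [ChartedSpace (Base n) N]

variable (n) in
/-- Smooth injective self-maps along which critical points of functions are reflected. -/
structure ReflectsCritical (η : N → N) : Prop where
  contMDiff : ContMDiff (𝓡 n) (𝓡 n) ∞ η
  injective : Injective η
  reflects : ∀ f : N → ℝ, ContMDiff (𝓡 n) 𝓘(ℝ, ℝ) ∞ f → ∀ x,
    mfderiv (𝓡 n) 𝓘(ℝ, ℝ) (f ∘ η) x = 0 → mfderiv (𝓡 n) 𝓘(ℝ, ℝ) f (η x) = 0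

theorem ReflectsCritical.iterate {η : N → N} (h : ReflectsCritical n η) (k : ℕ) :
    ReflectsCritical n (η^[k]) := by
  induction k with
  | zero => exact ⟨contMDiff_id, injective_id, fun f _ x hx => hx⟩
  | succ k ih =>
    refine ⟨ih.contMDiff.comp h.contMDiff, ih.injective.comp h.injective, fun f hf x hx => ?_⟩
    rw [iterate_succ, ← Function.comp_assoc] at hx
    exact ih.reflects f hf (η x) (h.reflects _ (hf.comp ih.contMDiff) x hx)

variable [IsManifold (𝓡 n) ∞ N]

/-- The radial expansion is transported by the chart and extended by the identity. The extension is
smooth because the closed ball has compact, hence closed, image in `N`, off which nothing moves.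
Critical points are reflected because the derivative of ρ is onto. -/
theorem exists_chart_expansion [T2Space N] (c : N) {z₀ : Base n} {r' r : ℝ} (hr' : 0 < r')
    (hr : r' < r) (hball : Metric.closedBall z₀ r ⊆ (extChartAt (𝓡 n) c).target) :
    ∃ ε > (0 : ℝ), ∃ η : N → N, ReflectsCritical n η ∧
      (∀ x ∉ (extChartAt (𝓡 n) c).source ∩ extChartAt (𝓡 n) c ⁻¹' Metric.ball z₀ r, η x = x) ∧
      ∀ z ∈ Metric.closedBall z₀ r', η ((extChartAt (𝓡 n) c).symm z) =
        (extChartAt (𝓡 n) c).symm (z₀ + (1 + ε) • (z - z₀)) := by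
  classical
  obtain ⟨ε, hε, ρ, hρs, hρi, hρd, hρo, hρe⟩ := exists_radial_expansion z₀ hr' hr
  set φ := extChartAt (𝓡 n) c with hφ
  have hρball : ∀ z ∈ Metric.ball z₀ r, ρ z ∈ Metric.ball z₀ r := by
    intro z hz
    by_contra h
    have := hρi (hρo _ h)
    exact h (by rwa [this])
  have hρt : ∀ z ∈ φ.target, ρ z ∈ φ.target := by
    intro z hz
    by_cases h : z ∈ Metric.ball z₀ r
    · exact hball (Metric.ball_subset_closedBall (hρball z h))
    · rwa [hρo z h]
  set η : N → N := fun x => if x ∈ φ.source then φ.symm (ρ (φ x)) else x with hη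
  have hηs : ∀ x ∈ φ.source, η x = φ.symm (ρ (φ x)) := fun x hx => if_pos hx
  have hηn : ∀ x ∉ φ.source, η x = x := fun x hx => if_neg hx
  have hηsrc : ∀ x ∈ φ.source, η x ∈ φ.source := by
    intro x hx
    rw [hηs x hx]
    exact φ.map_target (hρt _ (φ.map_source hx))
  have hφη : ∀ x ∈ φ.source, φ (η x) = ρ (φ x) := by
    intro x hx
    rw [hηs x hx, φ.right_inv (hρt _ (φ.map_source hx))]
  have hso : IsOpen φ.source := isOpen_extChartAt_source c
  have hoff : ∀ x ∉ φ.source ∩ φ ⁻¹' Metric.ball z₀ r, η x = x := by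
    intro x hx
    by_cases hxs : x ∈ φ.source
    · rw [hηs x hxs, hρo _ (fun h => hx ⟨hxs, h⟩), φ.left_inv hxs]
    · exact hηn x hxs
  set K : Set N := φ.symm '' Metric.closedBall z₀ r with hK
  have hKc : IsClosed K := ((isCompact_closedBall z₀ r).image_of_continuousOn
    ((continuousOn_extChartAt_symm c).mono hball)).isClosed
  have hKs : K ⊆ φ.source := by
    rintro _ ⟨z, hz, rfl⟩
    exact φ.map_target (hball hz)
  have hid : ∀ x ∉ K, η =ᶠ[𝓝 x] id := by
    intro x hx
    filter_upwards [hKc.isOpen_compl.mem_nhds hx] with y hy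
    refine hoff y fun h => hy ⟨φ y, Metric.ball_subset_closedBall h.2, φ.left_inv h.1⟩
  have hloc : ∀ x ∈ φ.source, η =ᶠ[𝓝 x] φ.symm ∘ ρ ∘ φ := by
    intro x hx
    filter_upwards [hso.mem_nhds hx] with y hy using hηs y hy
  have hηsm : ContMDiff (𝓡 n) (𝓡 n) ∞ η := by
    intro x
    by_cases hx : x ∈ φ.source
    · refine ContMDiffAt.congr_of_eventuallyEq ?_ (hloc x hx)
      have h1 : ContMDiffAt (𝓡 n) 𝓘(ℝ, Base n) ∞ φ x :=
        contMDiffOn_extChartAt.contMDiffAt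
          (by rw [← extChartAt_source (𝓡 n)]; exact hso.mem_nhds hx)
      have h2 : ContMDiffAt 𝓘(ℝ, Base n) (𝓡 n) ∞ φ.symm (ρ (φ x)) :=
        (contMDiffOn_extChartAt_symm c).contMDiffAt
          ((isOpen_extChartAt_target c).mem_nhds (hρt _ (φ.map_source hx)))
      exact ContMDiffAt.comp x (g := φ.symm) h2 (hρs.contMDiff.contMDiffAt.comp x h1)
    · exact contMDiffAt_id.congr_of_eventuallyEq (hid x fun h => hx (hKs h))
  refine ⟨ε, hε, η, ⟨hηsm, ?_, ?_⟩, hoff, ?_⟩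
  · intro x y hxy
    by_cases hx : x ∈ φ.source
    · by_cases hy : y ∈ φ.source
      · have := congrArg φ hxy
        rw [hφη x hx, hφη y hy] at this
        exact φ.injOn hx hy (hρi this)
      · rw [hηn y hy] at hxy
        exact absurd (hxy ▸ hηsrc x hx) hy
    · by_cases hy : y ∈ φ.source
      · rw [hηn x hx] at hxy
        exact absurd (hxy ▸ hηsrc y hy) hx
      · rwa [hηn x hx, hηn y hy] at hxy
  · intro f hf x hx0
    by_cases hx : x ∈ φ.source
    · obtain ⟨A, hA⟩ := hasFDerivAt_comp_extChartAt_symm (hf.comp hηsm) hx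
      rw [hx0] at hA
      have hz : ((0 : TangentSpace (𝓡 n) x →L[ℝ] ℝ) ∘L A) = (0 : Dual n) :=
        ContinuousLinearMap.zero_comp A
      have hA0 : HasFDerivAt ((f ∘ η) ∘ φ.symm) (0 : Dual n) (φ x) := hz ▸ hA
      have hηx := hηsrc x hx
      obtain ⟨A', hA'⟩ := hasFDerivAt_comp_extChartAt_symm hf hηx
      have hg : HasFDerivAt (f ∘ φ.symm) (fderiv ℝ (f ∘ φ.symm) (ρ (φ x))) (ρ (φ x)) := by
        rw [← hφη x hx]
        exact hA'.differentiableAt.hasFDerivAt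
      have hcomp : HasFDerivAt ((f ∘ φ.symm) ∘ ρ)
          (fderiv ℝ (f ∘ φ.symm) (ρ (φ x)) ∘L fderiv ℝ ρ (φ x)) (φ x) :=
        hg.comp _ (hρs.differentiable (by simp) _).hasFDerivAt
      have heq : (f ∘ η) ∘ φ.symm =ᶠ[𝓝 (φ x)] (f ∘ φ.symm) ∘ ρ := by
        filter_upwards [(isOpen_extChartAt_target c).mem_nhds (φ.map_source hx)] with y hy
        simp only [Function.comp]
        rw [hηs _ (φ.map_target hy), φ.right_inv hy]
      have h0 := (hcomp.congr_of_eventuallyEq heq).unique hA0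
      have hg0 : fderiv ℝ (f ∘ φ.symm) (ρ (φ x)) = 0 := by
        ext v
        obtain ⟨u, rfl⟩ := hρd (φ x) v
        exact DFunLike.congr_fun h0 u
      rw [hg0] at hg
      have hfg : f =ᶠ[𝓝 (η x)] (f ∘ φ.symm) ∘ φ := by
        filter_upwards [hso.mem_nhds hηx] with y hy
        simp only [Function.comp]
        rw [φ.left_inv hy]
      have hφd : MDifferentiableAt (𝓡 n) 𝓘(ℝ, Base n) φ (η x) :=
        (contMDiffOn_extChartAt.contMDiffAt (n := 1)
          (by rw [← extChartAt_source (𝓡 n)]; exact hso.mem_nhds hηx)).mdifferentiableAt (by simp)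
      rw [← hφη x hx] at hg
      have hm := HasMFDerivAt.comp (η x) hg.hasMFDerivAt hφd.hasMFDerivAt
      rw [hfg.mfderiv_eq, hm.mfderiv]
      exact ContinuousLinearMap.zero_comp _
    · have hxK : x ∉ K := fun h => hx (hKs h)
      rw [hηn x hx]
      have : f ∘ η =ᶠ[𝓝 x] f := by
        filter_upwards [hid x hxK] with y hy
        simp only [Function.comp]
        rw [hy]
        rfl
      rwa [this.mfderiv_eq] at hx0
  · intro z hz
    have hzt : z ∈ φ.target := hball (Metric.closedBall_subset_closedBall hr.le hz)
    rw [hηs _ (φ.map_target hzt), φ.right_inv hzt, hρe z hz]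

/-- A chart ball can be compressed into any neighbourhood of its centre. -/
theorem exists_chart_compression [T2Space N] (c : N) {z₀ : Base n} {r' r : ℝ} (hr' : 0 < r')
    (hr : r' < r) (hball : Metric.closedBall z₀ r ⊆ (extChartAt (𝓡 n) c).target) {V : Set N}
    (hV : V ∈ 𝓝 ((extChartAt (𝓡 n) c).symm z₀)) :
    ∃ η : N → N, ReflectsCritical n η ∧
      (∀ x ∉ (extChartAt (𝓡 n) c).source ∩ extChartAt (𝓡 n) c ⁻¹' Metric.ball z₀ r, η x = x) ∧
      ∀ x, η x ∈ (extChartAt (𝓡 n) c).source ∩ extChartAt (𝓡 n) c ⁻¹' Metric.closedBall z₀ r' →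
        x ∈ V := by
  obtain ⟨ε, hε, η, hη, hoff, hexp⟩ := exists_chart_expansion c hr' hr hball
  set φ := extChartAt (𝓡 n) c with hφ
  have hz₀ : z₀ ∈ φ.target := hball (Metric.mem_closedBall_self (hr'.trans hr).le)
  have hpre : φ.symm ⁻¹' V ∈ 𝓝 z₀ :=
    (continuousAt_extChartAt_symm'' hz₀).preimage_mem_nhds hV
  obtain ⟨δ, hδ, hδV⟩ := Metric.mem_nhds_iff.mp hpre
  -- After k expansions the ball of radius r'/(1+ε)^k < δ already fills the ball of radius r'. By
  -- injectivity no point outside `V` can land there.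
  obtain ⟨k, hk⟩ := pow_unbounded_of_one_lt (r' / δ) (by linarith : 1 < 1 + ε)
  have h1ε : (0 : ℝ) < 1 + ε := by linarith
  have hit : ∀ k : ℕ, ∀ u : Base n, ‖u‖ ≤ r' →
      η^[k] (φ.symm (z₀ + ((1 + ε) ^ k)⁻¹ • u)) = φ.symm (z₀ + u) := by
    intro k
    induction k with
    | zero => intro u _; simp
    | succ k ih =>
      intro u hu
      have hle : ‖((1 + ε) ^ (k + 1))⁻¹ • u‖ ≤ r' := by
        rw [norm_smul, Real.norm_of_nonneg (by positivity)]
        calc ((1 + ε) ^ (k + 1))⁻¹ * ‖u‖ ≤ 1 * ‖u‖ := by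
              gcongr
              exact inv_le_one_of_one_le₀ (one_le_pow₀ (by linarith))
          _ ≤ r' := by rwa [one_mul]
      rw [iterate_succ_apply, hexp _ (by simpa [mem_closedBall_iff_norm] using hle),
        add_sub_cancel_left, smul_smul, ← ih u hu]
      congr 4
      field_simp
      ring
  refine ⟨η^[k], hη.iterate k, fun x hx => iterate_fixed (hoff x hx) k, fun x hx => ?_⟩
  set u := φ (η^[k] x) - z₀ with hu
  have hur : ‖u‖ ≤ r' := by
    have := hx.2
    rwa [mem_preimage, mem_closedBall_iff_norm] at this
  have h2 : η^[k] (φ.symm (z₀ + ((1 + ε) ^ k)⁻¹ • u)) = η^[k] x := by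
    rw [hit k u hur, hu, add_sub_cancel, φ.left_inv hx.1]
  have h3 := (hη.iterate k).injective h2
  rw [← h3]
  apply hδV
  rw [mem_ball_iff_norm, add_sub_cancel_left, norm_smul, Real.norm_of_nonneg (by positivity)]
  have hp : 0 < (1 + ε) ^ k := by positivity
  rw [inv_mul_lt_iff₀ hp]
  rw [div_lt_iff₀ hδ] at hk
  linarith

variable (n) in
/-- Smooth functions with finitely many critical points, all in `V`, can be modified so that
all critical points lie in `U`. -/
def CriticalPushable (U V : Set N) : Prop :=
  ∀ f : N → ℝ, ContMDiff (𝓡 n) 𝓘(ℝ, ℝ) ∞ f → {x | mfderiv (𝓡 n) 𝓘(ℝ, ℝ) f x = 0}.Finite →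
    {x | mfderiv (𝓡 n) 𝓘(ℝ, ℝ) f x = 0} ⊆ V →
    ∃ g : N → ℝ, ContMDiff (𝓡 n) 𝓘(ℝ, ℝ) ∞ g ∧ {x | mfderiv (𝓡 n) 𝓘(ℝ, ℝ) g x = 0} ⊆ U

/-- Replace f by f∘η with η a compression: its critical points are sent by η to those of f. Those
landing in the chart ball come from `V`, and all others are fixed by η, hence were already in `V`.
-/
theorem CriticalPushable.union_chartBall [T2Space N] {U V : Set N} (hP : CriticalPushable n U V)
    (c : N) {z₀ : Base n} {r : ℝ} (hr : 0 < r)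
    (hball : Metric.closedBall z₀ r ⊆ (extChartAt (𝓡 n) c).target)
    (hV : V ∈ 𝓝 ((extChartAt (𝓡 n) c).symm z₀)) :
    CriticalPushable n U
      (V ∪ (extChartAt (𝓡 n) c).source ∩ extChartAt (𝓡 n) c ⁻¹' Metric.ball z₀ r) := by
  intro f hf hfin hsub
  set B := (extChartAt (𝓡 n) c).source ∩ extChartAt (𝓡 n) c ⁻¹' Metric.ball z₀ r with hB
  set C := {x | mfderiv (𝓡 n) 𝓘(ℝ, ℝ) f x = 0} with hC
  -- Finiteness of the critical set is used here: those in the open ball lie in a strictly smaller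
  -- closed ball.
  obtain ⟨r', ⟨hr'C, hr'⟩, hr'r⟩ : ∃ r', ((∀ y ∈ C ∩ B, dist (extChartAt (𝓡 n) c y) z₀ ≤ r') ∧
      0 < r') ∧ r' < r := by
    have h1 : ∀ᶠ r' in 𝓝[<] r, ∀ y ∈ C ∩ B, dist (extChartAt (𝓡 n) c y) z₀ ≤ r' := by
      rw [Filter.eventually_all_finite (hfin.subset inter_subset_left)]
      intro y hy
      have : dist (extChartAt (𝓡 n) c y) z₀ < r := hy.2.2
      filter_upwards [nhdsWithin_le_nhds (lt_mem_nhds this)] with s hs using hs.le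
    have h2 : ∀ᶠ r' in 𝓝[<] r, 0 < r' := nhdsWithin_le_nhds (lt_mem_nhds hr)
    exact ((h1.and h2).and self_mem_nhdsWithin).exists
  obtain ⟨η, hη, hoff, hin⟩ := exists_chart_compression c hr' hr'r hball hV
  have hηB : ∀ x ∈ B, η x ∈ B := by
    intro x hx
    by_contra h
    exact h (by rwa [hη.injective (hoff _ h)])
  have hcrit : {x | mfderiv (𝓡 n) 𝓘(ℝ, ℝ) (f ∘ η) x = 0} ⊆ η ⁻¹' C := fun x hx =>
    hη.reflects f hf x hx
  refine hP (f ∘ η) (hf.comp hη.contMDiff)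
    ((hfin.preimage hη.injective.injOn).subset hcrit) fun x hx => ?_
  have hxC : η x ∈ C := hcrit hx
  by_cases hxB : η x ∈ B
  · exact hin x ⟨hxB.1, hr'C _ ⟨hxC, hxB⟩⟩
  · have hx' : x ∉ B := fun h => hxB (hηB x h)
    rw [hoff x hx'] at hxC hxB
    exact (hsub hxC).resolve_right hxB

/-- On a closed connected manifold there is a smooth function all of whose critical points lie in
a given non-empty open set. -/
theorem exists_contMDiff_critical_subset [T2Space N] [CompactSpace N] [ConnectedSpace N]
    {U : Set N} (hU : IsOpen U) (hne : U.Nonempty) :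
    ∃ f : N → ℝ, ContMDiff (𝓡 n) 𝓘(ℝ, ℝ) ∞ f ∧
      ∀ x, mfderiv (𝓡 n) 𝓘(ℝ, ℝ) f x = 0 → x ∈ U := by
  -- Quantifying over every open `T` containing `U` lets patches be adjoined one after another.
  set Ph : Set N → Prop := fun V => ∀ T, IsOpen T → U ⊆ T → CriticalPushable n U T →
    CriticalPushable n U (T ∪ V) with hPh
  set X : Set N := {x | ∃ V, IsOpen V ∧ x ∈ V ∧ Ph V} with hX
  have hXo : IsOpen X := by
    rw [isOpen_iff_mem_nhds]
    rintro x ⟨V, hVo, hxV, hV⟩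
    exact Filter.mem_of_superset (hVo.mem_nhds hxV) fun y hy => ⟨V, hVo, hy, hV⟩
  have hXU : U ⊆ X := by
    intro x hx
    refine ⟨U, hU, hx, fun T _ hUT hT => ?_⟩
    rwa [union_eq_self_of_subset_right hUT]
  -- Near a limit point x choose w with an admissible neighbourhood, at chart distance below R/2.
  -- The ball of radius R/2 about w contains x, stays in the chart, and has its centre in that
  -- neighbourhood, so it can be adjoined.
  have hXc : IsClosed X := by
    rw [← closure_subset_iff_isClosed]
    intro x hx
    obtain ⟨R, hR, hRt⟩ := Metric.nhds_basis_closedBall.mem_iff.mp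
      (extChartAt_target_mem_nhds (I := 𝓡 n) x)
    have hn : (extChartAt (𝓡 n) x).source ∩ extChartAt (𝓡 n) x ⁻¹'
        Metric.ball (extChartAt (𝓡 n) x x) (R / 2) ∈ 𝓝 x :=
      Filter.inter_mem (extChartAt_source_mem_nhds x)
        ((continuousAt_extChartAt x).preimage_mem_nhds (Metric.ball_mem_nhds _ (half_pos hR)))
    obtain ⟨w, ⟨hws, hwb⟩, V, hVo, hwV, hV⟩ := mem_closure_iff_nhds.mp hx _ hn
    have hwb' : dist (extChartAt (𝓡 n) x w) (extChartAt (𝓡 n) x x) < R / 2 := hwb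
    refine ⟨V ∪ (extChartAt (𝓡 n) x).source ∩ extChartAt (𝓡 n) x ⁻¹'
      Metric.ball (extChartAt (𝓡 n) x w) (R / 2), ?_, ?_, ?_⟩
    · exact hVo.union ((continuousOn_extChartAt x).isOpen_inter_preimage
        (isOpen_extChartAt_source x) Metric.isOpen_ball)
    · exact Or.inr ⟨mem_extChartAt_source x, by rwa [mem_preimage, Metric.mem_ball, dist_comm]⟩
    · intro T hTo hUT hT
      rw [← union_assoc]
      refine (hV T hTo hUT hT).union_chartBall x (half_pos hR) (fun z hz => hRt ?_) ?_
      · rw [Metric.mem_closedBall] at hz ⊢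
        linarith [dist_triangle z (extChartAt (𝓡 n) x w) (extChartAt (𝓡 n) x x)]
      · rw [(extChartAt (𝓡 n) x).left_inv hws]
        exact (hTo.union hVo).mem_nhds (Or.inr hwV)
  have hXuniv : X = univ := IsClopen.eq_univ ⟨hXc, hXo⟩ (hne.mono hXU)
  obtain ⟨V, hVo, huV, hV⟩ : ∃ V, IsOpen V ∧ (univ : Set N) ⊆ V ∧ Ph V := by
    refine isCompact_univ.induction_on (p := fun s => ∃ V, IsOpen V ∧ s ⊆ V ∧ Ph V)
      ⟨∅, isOpen_empty, subset_rfl, fun T _ _ hT => by rwa [union_empty]⟩ ?_ ?_ ?_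
    · rintro s t hst ⟨V, hVo, htV, hV⟩
      exact ⟨V, hVo, hst.trans htV, hV⟩
    · rintro s t ⟨V, hVo, hsV, hV⟩ ⟨V', hVo', htV, hV'⟩
      refine ⟨V ∪ V', hVo.union hVo', union_subset_union hsV htV, fun T hTo hUT hT => ?_⟩
      rw [← union_assoc]
      exact hV' _ (hTo.union hVo) (hUT.trans subset_union_left) (hV T hTo hUT hT)
    · intro x _
      obtain ⟨V, hVo, hxV, hV⟩ : x ∈ X := hXuniv ▸ mem_univ x
      exact ⟨V, mem_nhdsWithin_of_mem_nhds (hVo.mem_nhds hxV), V, hVo, subset_rfl, hV⟩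
  obtain ⟨f, hf, hfin⟩ := exists_contMDiff_finite_critical (n := n) N
  obtain ⟨g, hg, hgU⟩ := hV U hU subset_rfl (fun f hf _ h => ⟨f, hf, h⟩) f hf hfin
    fun x _ => Or.inr (huV (mem_univ x))
  exact ⟨g, hg, fun x hx => hgU hx⟩

/-! ### Fibrewise translations and displacement of sublevel sets. -/

/-- The differential of a function on `N`, as a covector field. -/
def dform (f : N → ℝ) (q : N) : Dual n :=
  mfderiv (𝓡 n) 𝓘(ℝ, ℝ) f q

/-- The covector of a point of `T*N`. -/
def momentum (x : Cotangent n N) : Dual n := x.2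

/-- Fibrewise translation of `T*N` by `s • df`. -/
def translate (f : N → ℝ) (s : ℝ) (x : Cotangent n N) : Cotangent n N :=
  ⟨x.proj, momentum x + s • dform (n := n) f x.proj⟩

theorem comp_tangentCoordChange_self (L : Dual n) (q : N) :
    L ∘L tangentCoordChange (𝓡 n) q q q = L :=
  ContinuousLinearMap.ext fun v =>
    congrArg L (tangentCoordChange_self (mem_extChartAt_source q) (v := v))

theorem fderiv_comp_extChartAt_symm {f : N → ℝ} (hf : ContMDiff (𝓡 n) 𝓘(ℝ, ℝ) ∞ f) {c q : N}
    (hq : q ∈ (extChartAt (𝓡 n) c).source) :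
    fderiv ℝ (f ∘ (extChartAt (𝓡 n) c).symm) (extChartAt (𝓡 n) c q) =
      (dform f q : Dual n) ∘L tangentCoordChange (𝓡 n) c q q := by
  have hqq : q ∈ (extChartAt (𝓡 n) q).source := mem_extChartAt_source q
  have e : HasFDerivAt (extChartAt (𝓡 n) q ∘ (extChartAt (𝓡 n) c).symm)
      (tangentCoordChange (𝓡 n) c q q) (extChartAt (𝓡 n) c q) := by
    have := hasFDerivWithinAt_tangentCoordChange (I := 𝓡 n) ⟨hq, hqq⟩
    rwa [ModelWithCorners.range_eq_univ, hasFDerivWithinAt_univ] at this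
  have hd : HasFDerivAt (f ∘ (extChartAt (𝓡 n) q).symm) (dform (n := n) f q)
      (extChartAt (𝓡 n) q q) := by
    have h : HasFDerivWithinAt (f ∘ (extChartAt (𝓡 n) q).symm) (dform (n := n) f q)
        (range (𝓡 n)) (extChartAt (𝓡 n) q q) :=
      ((hf q).mdifferentiableAt (by simp)).hasMFDerivAt.2
    exact h.hasFDerivAt (by rw [ModelWithCorners.range_eq_univ]; exact Filter.univ_mem)
  have h6 : (extChartAt (𝓡 n) q ∘ (extChartAt (𝓡 n) c).symm) (extChartAt (𝓡 n) c q) =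
      extChartAt (𝓡 n) q q := by
    rw [Function.comp_apply, (extChartAt (𝓡 n) c).left_inv hq]
  have h5 : f ∘ (extChartAt (𝓡 n) c).symm =ᶠ[𝓝 (extChartAt (𝓡 n) c q)]
      (f ∘ (extChartAt (𝓡 n) q).symm) ∘ (extChartAt (𝓡 n) q ∘ (extChartAt (𝓡 n) c).symm) := by
    have h2 : (extChartAt (𝓡 n) c).symm ⁻¹' (extChartAt (𝓡 n) q).source
        ∈ 𝓝 (extChartAt (𝓡 n) c q) := by
      apply (continuousAt_extChartAt_symm'' ((extChartAt (𝓡 n) c).map_source hq)).preimage_mem_nhds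
      rw [(extChartAt (𝓡 n) c).left_inv hq]
      exact (isOpen_extChartAt_source q).mem_nhds hqq
    filter_upwards [h2] with p hp
    simp only [Function.comp]
    rw [(extChartAt (𝓡 n) q).left_inv hp]
  have h7 := HasFDerivAt.comp (extChartAt (𝓡 n) c q) (by rw [h6]; exact hd) e
  exact (h7.congr_of_eventuallyEq h5).fderiv

theorem extChartAt_translate {f : N → ℝ} (hf : ContMDiff (𝓡 n) 𝓘(ℝ, ℝ) ∞ f) (s : ℝ)
    (x y : Cotangent n N) (hy : y.proj ∈ (chartAt (Base n) x.proj).source) :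
    extChartAt (cotangentModel n) x (translate f s y) =
      (extChartAt (𝓡 n) x.proj y.proj, (extChartAt (cotangentModel n) x y).2 +
        s • fderiv ℝ (f ∘ (extChartAt (𝓡 n) x.proj).symm) (extChartAt (𝓡 n) x.proj y.proj)) := by
  have hy' : y.proj ∈ (extChartAt (𝓡 n) x.proj).source := by rw [extChartAt_source]; exact hy
  rw [fderiv_comp_extChartAt_symm hf hy', cotangent_extChartAt_apply x y hy,
    cotangent_extChartAt_apply x (translate f s y) hy]
  rfl

theorem continuous_proj : Continuous (Bundle.TotalSpace.proj : Cotangent n N → N) :=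
  (Bundle.contMDiff_proj (n := 0) (IB := 𝓡 n) _).continuous

theorem continuousAt_of_extChartAt_comp {E H M X : Type*} [NormedAddCommGroup E] [NormedSpace ℝ E]
    [TopologicalSpace H] {I : ModelWithCorners ℝ E H} [TopologicalSpace M] [ChartedSpace H M]
    [TopologicalSpace X] {g : X → M} {p : X} (x : M)
    (hs : ∀ᶠ q in 𝓝 p, g q ∈ (extChartAt I x).source)
    (hg : ContinuousAt (fun q => extChartAt I x (g q)) p) : ContinuousAt g p := by
  have h2 : ContinuousAt (extChartAt I x).symm (extChartAt I x (g p)) :=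
    continuousAt_extChartAt_symm'' ((extChartAt I x).map_source hs.self_of_nhds)
  refine (ContinuousAt.comp (g := (extChartAt I x).symm)
    (f := fun q => extChartAt I x (g q)) h2 hg).congr ?_
  filter_upwards [hs] with q hq
  exact (extChartAt I x).left_inv hq

omit [IsManifold (𝓡 n) ∞ N] in
theorem continuousAt_fderiv_comp_extChartAt_symm {f : N → ℝ}
    (hf : ContMDiff (𝓡 n) 𝓘(ℝ, ℝ) ∞ f) (c : N) :
    ContinuousAt (fun q => fderiv ℝ (f ∘ (extChartAt (𝓡 n) c).symm) (extChartAt (𝓡 n) c q)) c := by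
  have h := (contMDiffAt_iff.mp (hf c)).2
  rw [ModelWithCorners.range_eq_univ, contDiffWithinAt_univ] at h
  have h' : ContDiffAt ℝ ∞ (f ∘ (extChartAt (𝓡 n) c).symm) (extChartAt (𝓡 n) c c) := h
  exact ContinuousAt.comp (g := fderiv ℝ (f ∘ (extChartAt (𝓡 n) c).symm))
    (h'.fderiv_right (m := 0) (by norm_cast)).continuousAt (continuousAt_extChartAt c)

theorem continuous_translate {f : N → ℝ} (hf : ContMDiff (𝓡 n) 𝓘(ℝ, ℝ) ∞ f) :
    Continuous fun p : ℝ × Cotangent n N => translate f p.1 p.2 := by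
  refine continuous_iff_continuousAt.mpr fun ⟨s, x⟩ => ?_
  have hproj : ContinuousAt (fun p : ℝ × Cotangent n N => p.2.proj) (s, x) :=
    (continuous_proj.comp continuous_snd).continuousAt
  have hsrc : ∀ᶠ p : ℝ × Cotangent n N in 𝓝 (s, x),
      p.2.proj ∈ (chartAt (Base n) x.proj).source :=
    hproj.preimage_mem_nhds
      ((chartAt (Base n) x.proj).open_source.mem_nhds (mem_chart_source _ _))
  refine continuousAt_of_extChartAt_comp (I := cotangentModel n) x ?_ ?_
  · filter_upwards [hsrc] with p hp
    rw [cotangent_extChartAt_source]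
    exact hp
  have hΦc : ContinuousAt (fun p : ℝ × Cotangent n N => (extChartAt (cotangentModel n) x p.2).2)
      (s, x) :=
    continuousAt_snd.comp (ContinuousAt.comp (g := extChartAt (cotangentModel n) x) (f := Prod.snd)
      (continuousAt_extChartAt x) continuousAt_snd)
  have hφc : ContinuousAt (fun p : ℝ × Cotangent n N => extChartAt (𝓡 n) x.proj p.2.proj) (s, x) :=
    ContinuousAt.comp (g := extChartAt (𝓡 n) x.proj) (f := fun p : ℝ × Cotangent n N => p.2.proj)
      (continuousAt_extChartAt x.proj) hproj
  have hDc : ContinuousAt (fun p : ℝ × Cotangent n N =>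
      fderiv ℝ (f ∘ (extChartAt (𝓡 n) x.proj).symm) (extChartAt (𝓡 n) x.proj p.2.proj)) (s, x) :=
    ContinuousAt.comp (f := fun p : ℝ × Cotangent n N => p.2.proj)
      (g := fun q => fderiv ℝ (f ∘ (extChartAt (𝓡 n) x.proj).symm) (extChartAt (𝓡 n) x.proj q))
      (continuousAt_fderiv_comp_extChartAt_symm hf x.proj) hproj
  have h2 := hφc.prodMk (hΦc.add (continuousAt_fst.smul hDc))
  refine h2.congr ?_
  filter_upwards [hsrc] with p hp
  exact (extChartAt_translate hf p.1 x p.2 hp).symm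

/-- In a canonical chart the curve is affine in s over a fixed base point. With `hamVF_comp_proj`
this identifies it as an integral curve for the Hamiltonian C·f∘π. -/
theorem hasMFDerivAt_translate {f : N → ℝ} (hf : ContMDiff (𝓡 n) 𝓘(ℝ, ℝ) ∞ f) (C : ℝ)
    (x : Cotangent n N) (s : ℝ) :
    HasMFDerivAt 𝓘(ℝ, ℝ) (cotangentModel n) (fun s => translate f (s * C) x) s
      ((1 : ℝ →L[ℝ] ℝ).smulRight
        (((0 : Base n), C • dform (n := n) f x.proj) : Base n × Dual n)) := by
  have hc : Continuous fun s : ℝ => translate f (s * C) x :=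
    (continuous_translate hf).comp ((continuous_id.mul continuous_const).prodMk continuous_const)
  refine ⟨hc.continuousAt, ?_⟩
  have hself : fderiv ℝ (f ∘ (extChartAt (𝓡 n) x.proj).symm) (extChartAt (𝓡 n) x.proj x.proj) =
      dform (n := n) f x.proj := by
    rw [fderiv_comp_extChartAt_symm hf (mem_extChartAt_source x.proj),
      comp_tangentCoordChange_self]
  set y := translate f (s * C) x with hy
  have h1 : HasDerivAt (fun t : ℝ => ((extChartAt (𝓡 n) x.proj x.proj,
      (extChartAt (cotangentModel n) y x).2 + (t * C) • dform (n := n) f x.proj) :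
      Base n × Dual n)) ((0 : Base n), C • dform (n := n) f x.proj) s := by
    refine (hasDerivAt_const s _).prodMk ?_
    have h2 : HasDerivAt (fun t : ℝ => t * C) C s := by
      simpa using (hasDerivAt_id s).mul_const C
    exact (h2.smul_const (dform (n := n) f x.proj)).const_add _
  have h3 : (fun t : ℝ => extChartAt (cotangentModel n) y (translate f (t * C) x)) =
      fun t : ℝ => ((extChartAt (𝓡 n) x.proj x.proj,
      (extChartAt (cotangentModel n) y x).2 + (t * C) • dform (n := n) f x.proj) :
      Base n × Dual n) := by
    funext t
    rw [extChartAt_translate hf (t * C) y x (mem_chart_source _ x.proj), ← hself]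
    rfl
  have h4 : HasFDerivAt (fun t : ℝ => extChartAt (cotangentModel n) y (translate f (t * C) x))
      ((1 : ℝ →L[ℝ] ℝ).smulRight
        (((0 : Base n), C • dform (n := n) f x.proj) : Base n × Dual n)) s := by
    rw [h3]
    exact h1.hasFDerivAt
  exact h4.hasFDerivWithinAt

theorem mfderiv_proj (x : Cotangent n N) (w : Base n × Dual n) :
    mfderiv (cotangentModel n) (𝓡 n) (Bundle.TotalSpace.proj : Cotangent n N → N) x w = w.1 := by
  have hd : MDifferentiableAt (cotangentModel n) (𝓡 n)
      (Bundle.TotalSpace.proj : Cotangent n N → N) x :=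
    ((Bundle.contMDiff_proj (n := 1) (IB := 𝓡 n) _) x).mdifferentiableAt (by simp)
  have h1 : writtenInExtChartAt (cotangentModel n) (𝓡 n) x
      (Bundle.TotalSpace.proj : Cotangent n N → N) =ᶠ[𝓝 (extChartAt (cotangentModel n) x x)]
      Prod.fst := by
    filter_upwards [extChartAt_target_mem_nhds (I := cotangentModel n) x] with z hz
    have hs := (extChartAt (cotangentModel n) x).map_target hz
    have hr := (extChartAt (cotangentModel n) x).right_inv hz
    rw [cotangent_extChartAt_source] at hs
    rw [cotangent_extChartAt_apply x _ hs] at hr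
    exact congrArg Prod.fst hr
  rw [hd.mfderiv, ModelWithCorners.range_eq_univ, fderivWithin_univ, h1.fderiv_eq]
  have h2 : fderiv ℝ (Prod.fst : Base n × Dual n → Base n) (extChartAt (cotangentModel n) x x) =
    ContinuousLinearMap.fst ℝ _ _ := fderiv_fst
  exact DFunLike.congr_fun h2 w

theorem hamVF_congr {F G : Cotangent n N → ℝ} {x : Cotangent n N} (h : F =ᶠ[𝓝 x] G) :
    hamVF F x = hamVF G x := by
  rw [eq_hamVF_iff]
  intro w
  rw [(eq_hamVF_iff F x _).mp rfl w]
  congr 1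
  change mfderiv (cotangentModel n) 𝓘(ℝ, ℝ) F x w = mfderiv (cotangentModel n) 𝓘(ℝ, ℝ) G x w
  rw [h.mfderiv_eq]
  rfl

theorem hamVF_zero (x : Cotangent n N) : hamVF (fun _ : Cotangent n N => (0 : ℝ)) x = 0 := by
  symm
  refine (eq_hamVF_iff _ x _).mpr fun w => ?_
  have h2 : differential (fun _ : Cotangent n N => (0 : ℝ)) x w = 0 := by
    change mfderiv (cotangentModel n) 𝓘(ℝ, ℝ) (fun _ : Cotangent n N => (0 : ℝ)) x w = 0
    rw [mfderiv_const]
    rfl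
  rw [h2]
  change (w : Base n × Dual n).2 0 - (0 : Dual n) (w : Base n × Dual n).1 = _
  simp

theorem hamVF_eq_zero_of_notMem {F : Cotangent n N → ℝ} {K : Set (Cotangent n N)}
    (hK : IsClosed K) (hF : ∀ x ∉ K, F x = 0) {x : Cotangent n N} (hx : x ∉ K) :
    hamVF F x = 0 := by
  have h1 : F =ᶠ[𝓝 x] fun _ => 0 := by
    filter_upwards [hK.isOpen_compl.mem_nhds hx] with y hy using hF y hy
  rw [hamVF_congr h1, hamVF_zero]

/-- A function pulled back from the base has no fibre derivative, so its Hamiltonian field is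
vertical. -/
theorem hamVF_comp_proj {f : N → ℝ} (hf : ContMDiff (𝓡 n) 𝓘(ℝ, ℝ) ∞ f) (C : ℝ)
    (x : Cotangent n N) :
    hamVF (fun y : Cotangent n N => C * f y.proj) x =
      (((0 : Base n), C • dform (n := n) f x.proj) : Base n × Dual n) := by
  symm
  refine (eq_hamVF_iff _ x _).mpr fun w => ?_
  have hp : HasMFDerivAt (cotangentModel n) (𝓡 n) (Bundle.TotalSpace.proj : Cotangent n N → N) x
      (mfderiv (cotangentModel n) (𝓡 n) (Bundle.TotalSpace.proj : Cotangent n N → N) x) :=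
    (((Bundle.contMDiff_proj (n := 1) (IB := 𝓡 n) _) x).mdifferentiableAt (by simp)).hasMFDerivAt
  have h1 := (((hf x.proj).mdifferentiableAt (by simp)).hasMFDerivAt.comp x hp).const_smul C
  have h2 : differential (fun y : Cotangent n N => C * f y.proj) x w =
      C * dform (n := n) f x.proj (w : Base n × Dual n).1 := by
    change mfderiv (cotangentModel n) 𝓘(ℝ, ℝ) (C • (f ∘ Bundle.TotalSpace.proj)) x w = _
    rw [h1.mfderiv, ← mfderiv_proj x w]
    rfl
  rw [h2]
  change (w : Base n × Dual n).2 0 -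
    (C • dform (n := n) f x.proj) (w : Base n × Dual n).1 = _
  rw [map_zero, zero_sub]
  rfl

/-- Momenta over `A` are bounded while df has no zero on its projection, so a large translation
leaves `A`. Testing against one vector v in a chart replaces a norm on covectors. -/
theorem exists_translate_disjoint [T2Space N] [CompactSpace N] {f : N → ℝ}
    (hf : ContMDiff (𝓡 n) 𝓘(ℝ, ℝ) ∞ f) {A : Set (Cotangent n N)} (hA : IsCompact A)
    (hcrit : ∀ x ∈ A, mfderiv (𝓡 n) 𝓘(ℝ, ℝ) f x.proj ≠ 0) :
    ∃ C : ℝ, ∀ x ∈ A, translate f C x ∉ A := by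
  have hπA : IsCompact (Bundle.TotalSpace.proj '' A) := hA.image continuous_proj
  -- Asking for all large C allows the local bounds to be combined by a maximum.
  suffices h : ∃ C₀ : ℝ, ∀ C ≥ C₀, ∀ x ∈ A, x.proj ∈ Bundle.TotalSpace.proj '' A →
      translate f C x ∉ A by
    obtain ⟨C, hC⟩ := h
    exact ⟨C, fun x hx => hC C le_rfl x hx ⟨x, hx, rfl⟩⟩
  refine hπA.induction_on (p := fun s => ∃ C₀ : ℝ, ∀ C ≥ C₀, ∀ x ∈ A, x.proj ∈ s →
      translate f C x ∉ A) ⟨0, by simp⟩ ?_ ?_ ?_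
  · rintro s t hst ⟨C₀, h⟩
    exact ⟨C₀, fun C hC x hx hxs => h C hC x hx (hst hxs)⟩
  · rintro s t ⟨C₀, h⟩ ⟨C₁, h'⟩
    refine ⟨max C₀ C₁, fun C hC x hx hxs => ?_⟩
    rcases hxs with hxs | hxs
    · exact h C ((le_max_left _ _).trans hC) x hx hxs
    · exact h' C ((le_max_right _ _).trans hC) x hx hxs
  · rintro _ ⟨x₀, hx₀, rfl⟩
    set q₀ := x₀.proj with hq₀
    set D : N → Dual n := fun q =>
      fderiv ℝ (f ∘ (extChartAt (𝓡 n) q₀).symm) (extChartAt (𝓡 n) q₀ q) with hD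
    have hDc : ContinuousAt D q₀ := continuousAt_fderiv_comp_extChartAt_symm hf q₀
    obtain ⟨v, hv⟩ : ∃ v, D q₀ v ≠ 0 := by
      by_contra! h
      apply hcrit x₀ hx₀
      have h1 : D q₀ = dform (n := n) f q₀ := (fderiv_comp_extChartAt_symm hf (mem_extChartAt_source q₀)).trans
        (comp_tangentCoordChange_self _ q₀)
      exact h1.symm.trans (ContinuousLinearMap.ext h)
    set δ := |D q₀ v| / 2 with hδ
    have hδpos : 0 < δ := half_pos (abs_pos.mpr hv)
    have hn : (extChartAt (𝓡 n) q₀).source ∩ {q | δ < |D q v|} ∈ 𝓝 q₀ := by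
      refine Filter.inter_mem (extChartAt_source_mem_nhds q₀) ?_
      have h1 : ContinuousAt (fun q => |D q v|) q₀ := (hDc.clm_apply continuousAt_const).abs
      exact h1.eventually (lt_mem_nhds (half_lt_self (abs_pos.mpr hv)))
    obtain ⟨W, hW, hWsub, hWc⟩ := local_compact_nhds hn
    have hAW : IsCompact (A ∩ Bundle.TotalSpace.proj ⁻¹' W) :=
      hA.inter_right (hWc.isClosed.preimage continuous_proj)
    have hsrc : ∀ x ∈ A ∩ Bundle.TotalSpace.proj ⁻¹' W,
        x ∈ (extChartAt (cotangentModel n) x₀).source := by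
      intro x hx
      rw [cotangent_extChartAt_source, mem_preimage, ← extChartAt_source (𝓡 n)]
      exact (hWsub hx.2).1
    have hℓ : ContinuousOn (fun x => (extChartAt (cotangentModel n) x₀ x).2 v)
        (A ∩ Bundle.TotalSpace.proj ⁻¹' W) := by
      have h1 : ContinuousOn (extChartAt (cotangentModel n) x₀)
        (A ∩ Bundle.TotalSpace.proj ⁻¹' W) := (continuousOn_extChartAt x₀).mono hsrc
      exact (continuous_snd.comp_continuousOn h1).clm_apply continuousOn_const
    obtain ⟨R, hR⟩ := hAW.exists_bound_of_continuousOn hℓ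
    -- If x and its translate both lay in `A`, their v-components would differ by at most 2|R|,
    -- whereas this threshold forces a shift of at least 2|R| + 1.
    refine ⟨W, mem_nhdsWithin_of_mem_nhds hW, (2 * |R| + 1) / δ, fun C hC x hx hxW hT => ?_⟩
    have hxs : x.proj ∈ (chartAt (Base n) x₀.proj).source := by
      rw [← extChartAt_source (𝓡 n)]
      exact (hWsub hxW).1
    have e := extChartAt_translate hf C x₀ x hxs
    have e2 : (extChartAt (cotangentModel n) x₀ (translate f C x)).2 v =
        (extChartAt (cotangentModel n) x₀ x).2 v + C * D x.proj v := by
      rw [e]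
      rfl
    have b1 := hR x ⟨hx, hxW⟩
    have b2 := hR (translate f C x) ⟨hT, hxW⟩
    rw [Real.norm_eq_abs] at b1 b2
    have hCpos : 0 < C := lt_of_lt_of_le (by positivity) hC
    have b3 : C * δ ≤ |C * D x.proj v| := by
      rw [abs_mul, abs_of_pos hCpos]
      exact mul_le_mul_of_nonneg_left (hWsub hxW).2.le hCpos.le
    have b4 : |C * D x.proj v| ≤ 2 * |R| := by
      have : C * D x.proj v = (extChartAt (cotangentModel n) x₀ (translate f C x)).2 v -
        (extChartAt (cotangentModel n) x₀ x).2 v := by rw [e2]; ring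
      rw [this]
      refine (abs_sub _ _).trans ?_
      linarith [le_abs_self R]
    have b5 : 2 * |R| + 1 ≤ C * δ := (div_le_iff₀ hδpos).mp hC
    linarith

/-- A sublevel set of a proper function which misses a cotangent fibre is displaceable. -/
theorem displaceable_sublevel [T2Space N] [CompactSpace N] [ConnectedSpace N]
    {H : Cotangent n N → ℝ} (hH : IsSmooth H) (hprop : ∀ c : ℝ, IsCompact (H ⁻¹' Iic c)) {c : ℝ}
    {q₀ : N} (hq₀ : ∀ x, H x ≤ c → x.proj ≠ q₀) :
    Displaceable (H ⁻¹' Iic c) (H ⁻¹' Iic c) := by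
  set A := H ⁻¹' Iic c with hAdef
  have hA : IsCompact A := hprop c
  have hHc : Continuous H := hH.continuous
  obtain ⟨f, hf, hcrit⟩ := exists_contMDiff_critical_subset (n := n)
    (U := (Bundle.TotalSpace.proj '' A)ᶜ) (hA.image continuous_proj).isClosed.isOpen_compl
    ⟨q₀, by rintro ⟨x, hx, h⟩; exact hq₀ x hx h⟩
  obtain ⟨C, hC⟩ := exists_translate_disjoint hf hA
    fun x hx h => hcrit _ h ⟨x, hx, rfl⟩
  have hT : Continuous fun p : ℝ × Cotangent n N => translate f (p.1 * C) p.2 :=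
    (continuous_translate hf).comp
      ((continuous_fst.mul continuous_const).prodMk continuous_snd)
  -- On this larger sublevel the cut-off Hamiltonian equals C·f∘π, so translates of `A` follow its
  -- flow. The range [-1, 2] leaves an open interval around [0, 1] for the uniqueness theorem.
  obtain ⟨c', hc'⟩ : ∃ c', ∀ s ∈ Icc (-1 : ℝ) 2, ∀ x ∈ A, H (translate f (s * C) x) < c' := by
    obtain ⟨b, hb⟩ := ((isCompact_Icc (a := (-1 : ℝ)) (b := 2)).prod hA).exists_bound_of_continuousOn
      (hHc.comp hT).continuousOn
    exact ⟨b + 1, fun s hs x hx => by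
      have := (le_abs_self _).trans (hb (s, x) ⟨hs, hx⟩)
      simp only [Function.comp] at this
      linarith⟩
  set F : Cotangent n N → ℝ := fun x =>
    Real.smoothTransition (c' + 1 - H x) * (C * f x.proj) with hF
  have hFs : IsSmooth F := by
    have h1 : ContMDiff (cotangentModel n) 𝓘(ℝ, ℝ) ∞
        fun x : Cotangent n N => Real.smoothTransition (c' + 1 - H x) :=
      (Real.smoothTransition.contDiff.comp (contDiff_const.sub contDiff_id)).contMDiff.comp hH
    have h2 : ContMDiff (cotangentModel n) 𝓘(ℝ, ℝ) ∞ fun x : Cotangent n N => C * f x.proj :=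
      contMDiff_const.mul (hf.comp (Bundle.contMDiff_proj _))
    exact h1.mul h2
  have hF0 : ∀ x ∉ H ⁻¹' Iic (c' + 1), F x = 0 := by
    intro x hx
    have : c' + 1 < H x := not_le.mp hx
    simp only [hF]
    rw [Real.smoothTransition.zero_of_nonpos (by linarith), zero_mul]
  have hvK : ∀ x ∉ H ⁻¹' Iic (c' + 1), hamVF F x = 0 := fun x =>
    hamVF_eq_zero_of_notMem (hprop (c' + 1)).isClosed hF0
  have hv1 : ∀ x, H x < c' → hamVF F x =
      (((0 : Base n), C • dform (n := n) f x.proj) : Base n × Dual n) := by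
    intro x hx
    rw [← hamVF_comp_proj hf C x]
    apply hamVF_congr
    filter_upwards [(isOpen_Iio.preimage hHc).mem_nhds hx] with y hy
    have : H y < c' := hy
    simp only [hF]
    rw [Real.smoothTransition.one_of_one_le (by linarith), one_mul]
  obtain ⟨φ, hφc, hφ0, hφ⟩ := exists_continuous_flow_of_compact_support
    (contMDiff_hamVF hFs) (hprop (c' + 1)) hvK
  refine ⟨φ 1, ⟨fun _ => F, φ, ⟨?_, fun _ _ => rfl, H ⁻¹' Iic (c' + 1), hprop _,
    fun _ => hF0⟩, ⟨hφc, hφ0, fun t x => hφ x t⟩, rfl⟩, ?_⟩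
  · exact ContMDiff.comp (g := F) hFs contMDiff_snd
  · rw [hA.isClosed.closure_eq, eq_empty_iff_forall_notMem]
    rintro _ ⟨⟨x, hx, rfl⟩, hxA⟩
    have hcurve : IsMIntegralCurveOn (fun s : ℝ => translate f (s * C) x) (hamVF F)
        (Ioo (-1 : ℝ) 2) := by
      intro s hs
      rw [hv1 _ (hc' s (Ioo_subset_Icc_self hs) x hx)]
      exact (hasMFDerivAt_translate hf C x s).hasMFDerivWithinAt
    have heq := isMIntegralCurveOn_Ioo_eqOn_of_contMDiff_boundaryless (t₀ := 0)
      (by norm_num : (0 : ℝ) ∈ Ioo (-1 : ℝ) 2) (contMDiff_hamVF hFs)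
      ((hφ x).isMIntegralCurveOn _) hcurve (by
        rw [hφ0, zero_mul, translate, zero_smul, add_zero]
        rfl)
      (by norm_num : (1 : ℝ) ∈ Ioo (-1 : ℝ) 2)
    simp only [one_mul] at heq
    rw [heq] at hxA
    exact hC x hx hxA

/-! ### Poisson commutation, Hamiltonian maps and basic properties of quasi-states. -/

theorem omega_swap (x : Cotangent n N) (v w : Tangent x) : omega x v w = -omega x w v := by
  simp only [omega]
  ring

theorem omega_hamVF (F : Cotangent n N → ℝ) (x : Cotangent n N) (w : Tangent x) :
    omega x (hamVF F x) w = -differential F x w :=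
  (eq_hamVF_iff F x _).mp rfl w

theorem differential_comp {F : Cotangent n N → ℝ} (hF : IsSmooth F) {a : ℝ → ℝ}
    (ha : ContDiff ℝ ∞ a) (x : Cotangent n N) (w : Tangent x) :
    differential (fun y => a (F y)) x w = deriv a (F x) * differential F x w := by
  have hF' := ((hF x).mdifferentiableAt (by simp)).hasMFDerivAt
  have ha' : HasMFDerivAt 𝓘(ℝ, ℝ) 𝓘(ℝ, ℝ) a (F x)
      ((1 : ℝ →L[ℝ] ℝ).smulRight (deriv a (F x))) :=
    ((ha.differentiable (by simp)) (F x)).hasDerivAt.hasFDerivAt.hasMFDerivAt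
  have h := (ha'.comp x hF').mfderiv
  have h2 : differential (fun y => a (F y)) x w = differential F x w * deriv a (F x) :=
    DFunLike.congr_fun h w
  exact h2.trans (mul_comm _ _)

/-- Functions of one function Poisson commute. -/
theorem poisson_comp_comp {F : Cotangent n N → ℝ} (hF : IsSmooth F) {a b : ℝ → ℝ}
    (ha : ContDiff ℝ ∞ a) (hb : ContDiff ℝ ∞ b) (x : Cotangent n N) :
    poisson (fun y => a (F y)) (fun y => b (F y)) x = 0 := by
  have h0 : differential F x (hamVF F x) = 0 := by
    have h := omega_hamVF F x (hamVF F x)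
    have h' := omega_swap x (hamVF F x) (hamVF F x)
    linarith
  have h1 : differential F x (hamVF (fun y => b (F y)) x) = 0 := by
    have h := omega_hamVF F x (hamVF (fun y => b (F y)) x)
    rw [omega_swap, omega_hamVF, differential_comp hF hb, h0, mul_zero] at h
    linarith
  rw [poisson, omega_hamVF, differential_comp hF ha, h1, mul_zero, neg_zero]

theorem Displaceable.mono {X X' Y Y' : Set (Cotangent n N)} (h : Displaceable X' Y')
    (hX : X ⊆ X') (hY : Y ⊆ Y') : Displaceable X Y := by
  obtain ⟨ψ, hψ, h⟩ := h
  exact ⟨ψ, hψ, subset_empty_iff.mp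
    ((inter_subset_inter (image_mono hX) (closure_mono hY)).trans h.subset)⟩

theorem continuous_of_mem_Ham {ψ : Cotangent n N → Cotangent n N} (hψ : ψ ∈ Ham n N) :
    Continuous ψ := by
  obtain ⟨H, φ, -, hφ, rfl⟩ := hψ
  exact hφ.continuous.comp (Continuous.prodMk continuous_const continuous_id)

/-- Needed so that composing with ψ preserves compact support. While a trajectory is off `K` it is
an integral curve of the zero field; comparison with this autonomous field shows that the times at
which it sits at its starting point form a clopen set. -/
theorem exists_isCompact_eq_self_of_mem_Ham [T2Space N] {ψ : Cotangent n N → Cotangent n N}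
    (hψ : ψ ∈ Ham n N) : ∃ K, IsCompact K ∧ ∀ x ∉ K, ψ x = x := by
  obtain ⟨H, φ, hH, hφ, rfl⟩ := hψ
  obtain ⟨K, hK, hHK⟩ := hH.compactSupport
  refine ⟨K, hK, fun x hx => ?_⟩
  have hc : Continuous fun t => φ t x :=
    hφ.continuous.comp (Continuous.prodMk continuous_id continuous_const)
  have hclosed : IsClosed {t | φ t x = x} := isClosed_eq hc continuous_const
  have hopen : IsOpen {t | φ t x = x} := by
    refine isOpen_iff_mem_nhds.mpr fun t ht => ?_
    have ht' : φ t x = x := ht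
    have hn : (fun t => φ t x) ⁻¹' Kᶜ ∈ 𝓝 t :=
      (hK.isClosed.isOpen_compl.preimage hc).mem_nhds (by
        change φ t x ∉ K
        rwa [ht'])
    obtain ⟨δ, hδ, hδK⟩ := Metric.mem_nhds_iff.mp hn
    rw [Real.ball_eq_Ioo] at hδK
    have htI : t ∈ Ioo (t - δ) (t + δ) := ⟨by linarith, by linarith⟩
    have h1 : IsMIntegralCurveOn (fun s => φ s x) (hamVF fun _ : Cotangent n N => (0 : ℝ))
        (Ioo (t - δ) (t + δ)) := by
      intro s hs
      have h := (hφ.deriv s x).hasMFDerivWithinAt (s := Ioo (t - δ) (t + δ))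
      rw [hamVF_eq_zero_of_notMem hK.isClosed (hHK s) (hδK hs)] at h
      rw [hamVF_zero]
      exact h
    have h2 : IsMIntegralCurveOn (fun _ => x) (hamVF fun _ : Cotangent n N => (0 : ℝ))
        (Ioo (t - δ) (t + δ)) :=
      (isMIntegralCurve_const (hamVF_zero x)).isMIntegralCurveOn _
    have h3 := isMIntegralCurveOn_Ioo_eqOn_of_contMDiff_boundaryless htI
      (contMDiff_hamVF contMDiff_const) h1 h2 ht'
    exact Filter.mem_of_superset (isOpen_Ioo.mem_nhds htI) fun s hs => h3 hs
  have h := IsClopen.eq_univ ⟨hclosed, hopen⟩ ⟨0, hφ.zero x⟩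
  exact h.symm.subset (mem_univ (1 : ℝ))

theorem PartialSymplecticQuasiState.map_zero (ζ : PartialSymplecticQuasiState n N) :
    ζ.toFun 0 = 0 := by
  obtain ⟨K, -, -, h⟩ := ζ.normalization
  exact h 0 0 fun _ _ => rfl

theorem PartialSymplecticQuasiState.mono (ζ : PartialSymplecticQuasiState n N)
    {F G : C_c(Cotangent n N, ℝ)} (h : ∀ x, F x ≤ G x) : ζ.toFun F ≤ ζ.toFun G := by
  have h1 := (ζ.stability G F).1
  have h2 : 0 ≤ ⨅ x, (G x - F x) := Real.iInf_nonneg fun x => sub_nonneg.mpr (h x)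
  linarith

theorem IsSuperheavy.le_of_forall_le {ζ : PartialSymplecticQuasiState n N}
    {S : Set (Cotangent n N)} (hS : IsSuperheavy ζ S) {F : C_c(Cotangent n N, ℝ)} {c : ℝ}
    (h : ∀ x ∈ S, F x ≤ c) : ζ.toFun F ≤ c := by
  have h1 := (hS.2 F).trans (iSup₂_le fun x hx => EReal.coe_le_coe_iff.mpr (h x hx))
  exact EReal.coe_le_coe_iff.mp h1

section Proper

variable {H : Cotangent n N → ℝ}

/-- H is bounded on the compact set {H ≤ 0} and positive elsewhere. Without a lower bound the real
infimum in `fiberMin` would take a default value. -/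
theorem bddBelow_of_isCompact_sublevel (hH : Continuous H)
    (hprop : ∀ c : ℝ, IsCompact (H ⁻¹' Iic c)) : BddBelow (range H) := by
  obtain ⟨b, hb⟩ := (hprop 0).exists_bound_of_continuousOn hH.continuousOn
  refine ⟨min (-b) 0, ?_⟩
  rintro _ ⟨x, rfl⟩
  rcases le_or_gt (H x) 0 with h | h
  · exact (min_le_left _ _).trans (neg_le_of_abs_le (hb x h))
  · exact (min_le_right _ _).trans h.le

omit [IsManifold (𝓡 n) ∞ N] in
theorem fiberMin_le (hH : BddBelow (range H)) (x : Cotangent n N) :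
    fiberMin H x.proj ≤ H x := by
  obtain ⟨b, hb⟩ := hH
  exact ciInf_le (f := fun p : TangentSpace (𝓡 n) x.proj →L[ℝ] Bundle.Trivial N ℝ x.proj =>
    H ⟨x.proj, p⟩) ⟨b, by rintro _ ⟨p, rfl⟩; exact hb ⟨_, rfl⟩⟩ x.2

/-- The compact zero section meets every fibre and bounds the minima from above, so the supremum in
`maxMin` is genuine. -/
theorem bddAbove_fiberMin [CompactSpace N] (hHc : Continuous H) (hH : BddBelow (range H)) :
    BddAbove (range (fiberMin H)) := by
  have hz : Continuous (Bundle.zeroSection (Dual n)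
      (fun q : N => TangentSpace (𝓡 n) q →L[ℝ] Bundle.Trivial N ℝ q)) :=
    (Bundle.contMDiff_zeroSection (IB := 𝓡 n) (n := 0) ℝ _).continuous
  obtain ⟨b, hb⟩ := (isCompact_range (hHc.comp hz)).bddAbove
  refine ⟨b, ?_⟩
  rintro _ ⟨q, rfl⟩
  exact (fiberMin_le hH (Bundle.zeroSection (Dual n) _ q)).trans (hb ⟨q, rfl⟩)

theorem displaceable_sublevel_of_lt_maxMin [T2Space N] [CompactSpace N] [ConnectedSpace N]
    (hH : IsSmooth H) (hprop : ∀ c : ℝ, IsCompact (H ⁻¹' Iic c)) {c : ℝ} (hc : c < maxMin H) :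
    Displaceable (H ⁻¹' Iic c) (H ⁻¹' Iic c) := by
  obtain ⟨q₀, hq₀⟩ := exists_lt_of_lt_ciSup hc
  refine displaceable_sublevel hH hprop (q₀ := q₀) fun x hx h => ?_
  subst h
  exact absurd (hq₀.trans_le (fiberMin_le (bddBelow_of_isCompact_sublevel hH.continuous hprop) x))
    hx.not_gt

/-- A continuous function of a proper function as an element of `C_c(T*N)`. -/
def compOfProper (hH : Continuous H) (hprop : ∀ c : ℝ, IsCompact (H ⁻¹' Iic c)) (a : ℝ → ℝ)
    (ha : Continuous a) (c : ℝ) (hc : ∀ t, c < t → a t = 0) [T2Space N] :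
    C_c(Cotangent n N, ℝ) where
  toFun x := a (H x)
  continuous_toFun := ha.comp hH
  hasCompactSupport' := HasCompactSupport.intro (hprop c) fun _ hx => hc _ (not_le.mp hx)

/-- A smooth partition of unity on `(-∞, m]` with one member concentrated around `m`. -/
theorem exists_cutoff_near (m : ℝ) {ε : ℝ} (hε : 0 < ε) :
    ∃ a b : ℝ → ℝ, ContDiff ℝ ∞ a ∧ ContDiff ℝ ∞ b ∧ (∀ t, m - ε / 2 < t → a t = 0) ∧
      (∀ t, b t ≤ 1) ∧ (∀ t, ε < |t - m| → b t = 0) ∧ ∀ t, t ≤ m → a t + b t = 1 := by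
  -- `a` is 1 up to m - ε and 0 from m - ε/2 on; `b` is the complement of `a`, cut off between m and
  -- m + ε.
  set a : ℝ → ℝ := fun t => Real.smoothTransition ((m - ε / 2 - t) / (ε / 2)) with ha
  set b : ℝ → ℝ := fun t => (1 - a t) * Real.smoothTransition ((m + ε - t) / ε) with hb
  have has : ContDiff ℝ ∞ a := Real.smoothTransition.contDiff.comp
    ((contDiff_const.sub contDiff_id).div_const _)
  refine ⟨a, b, has, (contDiff_const.sub has).mul
    (Real.smoothTransition.contDiff.comp ((contDiff_const.sub contDiff_id).div_const _)),
    fun t ht => ?_, fun t => ?_, fun t ht => ?_, fun t ht => ?_⟩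
  · exact Real.smoothTransition.zero_of_nonpos
      (div_nonpos_of_nonpos_of_nonneg (by linarith) (by linarith))
  · exact mul_le_one₀ (sub_le_self _ (Real.smoothTransition.nonneg _))
      (Real.smoothTransition.nonneg _) (Real.smoothTransition.le_one _)
  · simp only [hb]
    rcases lt_abs.mp ht with h | h
    · rw [Real.smoothTransition.zero_of_nonpos
        (div_nonpos_of_nonpos_of_nonneg (by linarith) hε.le), mul_zero]
    · have h1 : a t = 1 :=
        Real.smoothTransition.one_of_one_le ((one_le_div (by linarith)).mpr (by linarith))
      rw [h1, sub_self, zero_mul]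
  · simp only [hb]
    rw [Real.smoothTransition.one_of_one_le ((one_le_div hε).mpr (by linarith))]
    ring

/-! ### Positivity near the critical level and non-displaceability. -/

/-- The level sets near `m_H` carry functions on which a quasi-state with a superheavy set
satisfying `(⋆)` is positive. -/
theorem exists_pos_of_isSuperheavy [T2Space N] [CompactSpace N] [ConnectedSpace N]
    {S : Set (Cotangent n N)} (hH : IsSmooth H) (hstar : StarCondition S H)
    {ζ : PartialSymplecticQuasiState n N} (hS : IsSuperheavy ζ S) {ε : ℝ} (hε : 0 < ε) :
    ∃ F : C_c(Cotangent n N, ℝ), (∀ x, F x ≤ 1) ∧ (∀ x, ε < |H x - maxMin H| → F x = 0) ∧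
      0 < ζ.toFun F := by
  have hHc : Continuous H := hH.continuous
  have hprop := hstar.isCompact_sublevel
  obtain ⟨a, b, has, hbs, ha0, hb1, hb0, hab⟩ := exists_cutoff_near (maxMin H) hε
  obtain ⟨f, hf⟩ : ∃ f : C_c(Cotangent n N, ℝ), ⇑f = fun x => a (H x) :=
    ⟨compOfProper hHc hprop a has.continuous _ ha0, rfl⟩
  obtain ⟨g, hg⟩ : ∃ g : C_c(Cotangent n N, ℝ), ⇑g = fun x => b (H x) :=
    ⟨compOfProper hHc hprop b hbs.continuous (maxMin H + ε)
      fun t ht => hb0 t (lt_abs.mpr (Or.inl (by linarith))), rfl⟩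
  have hadd : ContDiff ℝ ∞ fun t => a t + b t := has.add hbs
  have hadd' : ContDiff ℝ ∞ fun t => -(a t + b t) := hadd.neg
  have hfg : ⇑(f + g) = fun x => (fun t => a t + b t) (H x) := by
    rw [CompactlySupportedContinuousMap.coe_add, hf, hg]
    rfl
  have hneg : ⇑(-(f + g)) = fun x => (fun t => -(a t + b t)) (H x) := by
    rw [CompactlySupportedContinuousMap.coe_neg, hfg]
    rfl
  have hζf : ζ.toFun f = 0 := by
    have hsub : tsupport f ⊆ H ⁻¹' Iic (maxMin H - ε / 2) := by
      refine closure_minimal (fun x hx => ?_) (hprop _).isClosed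
      by_contra h
      exact hx (by rw [hf]; exact ha0 _ (not_le.mp h))
    exact ζ.vanishing f
      ((displaceable_sublevel_of_lt_maxMin hH hprop (by linarith)).mono hsub hsub)
  have hsub : ∀ (u v : C_c(Cotangent n N, ℝ)) (c d : ℝ → ℝ), ContDiff ℝ ∞ c → ContDiff ℝ ∞ d →
      (⇑u = fun x => c (H x)) → (⇑v = fun x => d (H x)) →
      ζ.toFun (u + v) ≤ ζ.toFun u + ζ.toFun v := by
    intro u v c d hc hd hu hv
    have hus : IsSmooth (n := n) (N := N) u := by
      rw [hu]
      exact hc.contMDiff.comp hH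
    have hvs : IsSmooth (n := n) (N := N) v := by
      rw [hv]
      exact hd.contMDiff.comp hH
    refine ζ.quasiSubadditivity u v hus hvs ?_
    rw [hu, hv]
    exact poisson_comp_comp hH hc hd
  -- Here ζ(f+g) ≤ 0 + ζ(g), and 0 = ζ(0) ≤ ζ(f+g) + ζ(-(f+g)) ≤ ζ(f+g) - 1, so in fact ζ(g) ≥ 1.
  have h1 := hsub f g _ _ has hbs hf hg
  have h2 := hsub (f + g) (-(f + g)) _ _ hadd hadd' hfg hneg
  rw [add_neg_cancel, ζ.map_zero] at h2
  have h3 : ζ.toFun (-(f + g)) ≤ -1 := by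
    refine hS.le_of_forall_le fun x hx => ?_
    have h1 : H x ≤ maxMin H := by
      rw [hstar.eq_fiberMin x hx]
      exact le_ciSup (bddAbove_fiberMin hHc (bddBelow_of_isCompact_sublevel hHc hprop)) x.proj
    rw [hneg]
    exact (congrArg Neg.neg (hab _ h1)).le
  refine ⟨g, fun x => ?_, fun x hx => ?_, by linarith⟩
  · rw [hg]
    exact hb1 _
  · rw [hg]
    exact hb0 _ hx

end Proper

theorem exists_pos_forall_lt_of_isCompact {X : Type*} [TopologicalSpace X] {K : Set X}
    (hK : IsCompact K) {g : X → ℝ} (hg : Continuous g) (h : ∀ x ∈ K, 0 < g x) :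
    ∃ δ > 0, ∀ x ∈ K, δ < g x := by
  rcases K.eq_empty_or_nonempty with rfl | hne
  · exact ⟨1, one_pos, by simp⟩
  · obtain ⟨x₀, hx₀, hmin⟩ := hK.exists_isMinOn hne hg.continuousOn
    exact ⟨g x₀ / 2, half_pos (h x₀ hx₀), fun x hx =>
      (half_lt_self (h x₀ hx₀)).trans_le (hmin hx)⟩

/-- By compactness a map displacing the level also displaces a neighbourhood |H - m| ≤ ε. Vanishing
then contradicts the positive function supported there. -/
theorem not_displaceable_self [T2Space N] [CompactSpace N] [ConnectedSpace N]
    {H : Cotangent n N → ℝ} {S : Set (Cotangent n N)} (hH : IsSmooth H)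
    (hstar : StarCondition S H) {ζ : PartialSymplecticQuasiState n N} (hS : IsSuperheavy ζ S) :
    ¬ Displaceable (H ⁻¹' {maxMin H}) (H ⁻¹' {maxMin H}) := by
  rintro ⟨ψ, hψ, hdisj⟩
  have hHc : Continuous H := hH.continuous
  have hψc := continuous_of_mem_Ham hψ
  set m := maxMin H with hm
  -- The maximum vanishes only where both x and ψ x are on the level, which is excluded. Taking `min
  -- δ 1` below keeps the neighbourhood inside {H ≤ m + 1}, where the bound holds.
  obtain ⟨δ, hδ, hδg⟩ := exists_pos_forall_lt_of_isCompact (hstar.isCompact_sublevel (m + 1))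
    (g := fun x => max |H x - m| |H (ψ x) - m|) (by fun_prop) (fun x _ => by
      by_contra hx
      obtain ⟨h1, h2⟩ := max_le_iff.mp (not_lt.mp hx)
      have h1' : H x = m := sub_eq_zero.mp (abs_nonpos_iff.mp h1)
      have h2' : H (ψ x) = m := sub_eq_zero.mp (abs_nonpos_iff.mp h2)
      exact (hdisj.subset ⟨⟨x, h1', rfl⟩, subset_closure h2'⟩).elim)
  have hε : 0 < min δ 1 := lt_min hδ one_pos
  obtain ⟨F, -, hF0, hFpos⟩ := exists_pos_of_isSuperheavy hH hstar hS hε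
  have hYc : IsClosed {x | |H x - m| ≤ min δ 1} := isClosed_le (by fun_prop) continuous_const
  have hsub : tsupport F ⊆ {x | |H x - m| ≤ min δ 1} := by
    refine closure_minimal (fun x hx => ?_) hYc
    by_contra h
    exact hx (hF0 x (not_le.mp h))
  refine hFpos.ne' (ζ.vanishing F (Displaceable.mono ⟨ψ, hψ, ?_⟩ hsub hsub))
  rw [hYc.closure_eq, eq_empty_iff_forall_notMem]
  rintro _ ⟨⟨x, hx, rfl⟩, hx'⟩
  have hx1 : |H x - m| ≤ min δ 1 := hx
  have hx2 : |H (ψ x) - m| ≤ min δ 1 := hx'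
  refine (hδg x ?_).not_ge ((max_le hx1 hx2).trans (min_le_left _ _))
  have := (le_abs_self _).trans (hx1.trans (min_le_right _ _))
  change H x ≤ m + 1
  linarith

/-- Invariance transports the upper bound by the supremum over `S` from a bump function G to G∘ψ,
which dominates a function with positive ζ. -/
theorem not_displaceable_of_isSuperheavy [T2Space N] [CompactSpace N] [ConnectedSpace N]
    {H : Cotangent n N → ℝ} {S : Set (Cotangent n N)} (hH : IsSmooth H)
    (hstar : StarCondition S H) {ζ : PartialSymplecticQuasiState n N} (hS : IsSuperheavy ζ S) :
    ¬ Displaceable (H ⁻¹' {maxMin H}) S := by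
  rintro ⟨ψ, hψ, hdisj⟩
  have hHc : Continuous H := hH.continuous
  have hψc := continuous_of_mem_Ham hψ
  set m := maxMin H with hm
  have hSc : IsClosed S := hS.1.isClosed
  rw [hSc.closure_eq] at hdisj
  have hprop := hstar.isCompact_sublevel
  obtain ⟨δ, hδ, hδg⟩ := exists_pos_forall_lt_of_isCompact
    ((hprop (m + 1)).inter_right (hSc.preimage hψc))
    (g := fun x => |H x - m|) (by fun_prop) (fun x hx => by
      refine abs_pos.mpr fun h => ?_
      exact (hdisj.subset ⟨⟨x, sub_eq_zero.mp h, rfl⟩, hx.2⟩).elim)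
  have hε : 0 < min δ 1 := lt_min hδ one_pos
  obtain ⟨F, hF1, hF0, hFpos⟩ := exists_pos_of_isSuperheavy hH hstar hS hε
  have hY : {x | |H x - m| ≤ min δ 1} ⊆ H ⁻¹' Iic (m + 1) := fun x hx => by
    have hx' : |H x - m| ≤ min δ 1 := hx
    have := (le_abs_self _).trans (hx'.trans (min_le_right _ _))
    change H x ≤ m + 1
    linarith
  have hYc : IsCompact {x | |H x - m| ≤ min δ 1} :=
    (hprop (m + 1)).of_isClosed_subset (isClosed_le (by fun_prop) continuous_const) hY
  -- Urysohn: G is 1 on the ψ-image of the compact neighbourhood of the level and 0 on `S`, which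
  -- that image misses by the choice of δ.
  obtain ⟨G, hG1, hG0, hGc, hG⟩ := exists_continuous_one_zero_of_isCompact (hYc.image hψc) hSc (by
    rw [Set.disjoint_left]
    rintro _ ⟨x, hx, rfl⟩ hxS
    exact (hδg x ⟨hY hx, hxS⟩).not_ge (le_trans hx (min_le_left _ _)))
  obtain ⟨K, hK, hψK⟩ := exists_isCompact_eq_self_of_mem_Ham hψ
  set G₁ : C_c(Cotangent n N, ℝ) := ⟨G, hGc⟩ with hG₁
  set G₂ : C_c(Cotangent n N, ℝ) := ⟨G.comp ⟨ψ, hψc⟩, by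
    refine HasCompactSupport.intro (hK.union hGc) fun x hx => ?_
    change G (ψ x) = 0
    rw [hψK x fun h => hx (Or.inl h)]
    exact image_eq_zero_of_notMem_tsupport fun h => hx (Or.inr h)⟩ with hG₂
  have h1 : ζ.toFun G₂ = ζ.toFun G₁ := ζ.hamInvariance ψ hψ G₁ G₂ fun _ => rfl
  have h2 : ζ.toFun G₁ ≤ 0 := hS.le_of_forall_le fun x hx => (hG0 hx).le
  have h3 : ζ.toFun F ≤ ζ.toFun G₂ := by
    refine ζ.mono fun x => ?_
    change F x ≤ G (ψ x)
    by_cases hx : |H x - m| ≤ min δ 1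
    · rw [hG1 ⟨x, hx, rfl⟩]
      exact hF1 x
    · rw [hF0 x (not_le.mp hx)]
      exact (hG (ψ x)).1
  linarith

end CotangentQS

end

theorem mainTheorem10 {n : ℕ} {N : Type*} [TopologicalSpace N]
    [ChartedSpace (EuclideanSpace ℝ (Fin n)) N] [IsManifold (𝓡 n) ∞ N]
    [T2Space N] [CompactSpace N] [ConnectedSpace N]
    (S : Set (CotangentQS.Cotangent n N)) (hS : IsCompact S)
    (H : CotangentQS.Cotangent n N → ℝ) (hH : CotangentQS.IsSmooth H)
    (hstar : CotangentQS.StarCondition S H)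
    (hsh : ∃ ζ : CotangentQS.PartialSymplecticQuasiState n N, CotangentQS.IsSuperheavy ζ S) :
    ¬ CotangentQS.Displaceable (H ⁻¹' {CotangentQS.maxMin H}) (H ⁻¹' {CotangentQS.maxMin H}) ∧
    ¬ CotangentQS.Displaceable (H ⁻¹' {CotangentQS.maxMin H}) S := by
  obtain ⟨ζ, hζ⟩ := hsh
  exact ⟨CotangentQS.not_displaceable_self hH hstar hζ,
    CotangentQS.not_displaceable_of_isSuperheavy hH hstar hζ⟩
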